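/- Fix integers $d\ge 2$ and $R\ge 1$. Let $n$ be an asymptotic index (for instance $n\in\mathbb N$, $n\to\infty$, or a multi-index of dimensions), and let $N_1,\dots,N_d$ be positive integers that may depend on $n$. Consider the $d$-way tensor factor model $$\mathbf Y=\sum_{r=1}^R\bigotimes_{j=1}^d v_{j,r}+\mathbf U\in\mathbb R^{N_1\times\dots\times N_d}$$ with deterministic nonzero vectors $v_{j,r}\in\mathbb R^{N_j}$ (which may depend on $n$). Put $m_{j,r}=v_{j,r}/\|v_{j,r}\|$, $\sigma_r=\prod_{j=1}^d\|v_{j,r}\|$, $D=\mathrm{diag}(\sigma_1,\dots,\sigma_R)$, with the factors labelled so that $\sigma_1\ge\dots\ge\sigma_R$, and $\sigma_k=0$ for $k\ge R+1$. Let $\delta_r=\min_{k\ne r}|\sigma_k^2-\sigma_r^2|$, where the minimum is over all integers $k\ge1$, $k\neq r$. Suppose that (a) for every $j$, $V_j^\top V_j$ is diagonal, where $V_j=(v_{j,1},\dots,v_{j,R})$; and (b) the entries of $\mathbf U$ are i.i.d. with a law that does not depend on $n$ and that has mean zero, variance $\sigma^2$ and a finite absolute moment of order $4+\epsilon$ for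 some $\epsilon>0$. Let $\mathbf Y_{(j)}\in\mathbb R^{N_j\times\prod_{k\ne j}N_k}$ be the mode-$j$ unfolding of $\mathbf Y$, and let $\hat m_{j,r}$ be a unit-norm eigenvector of $\mathbf Y_{(j)}\mathbf Y_{(j)}^\top$ corresponding to its $r$-th largest eigenvalue (counted with multiplicity), with the sign chosen so that $\langle\hat m_{j,r},m_{j,r}\rangle\ge0$. Then for all $1\le j\le d$ and $1\le r\le R$, $$\|\hat m_{j,r}-m_{j,r}\|=O_P\left(\frac{\sqrt{N_j}\,\mathrm{trace}(D)+N_j\vee\prod_{k\ne j}N_k}{\delta_r}\right),$$ where the right-hand side is read as $+\infty$ if $\delta_r=0$. Here $X_n=O_P(a_n)$ means that for every $\eta>0$ there is $C<\infty$ such that eventually $P(|X_n|>Ca_n)\le\eta$. -/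

import Mathlib

open MeasureTheory ProbabilityTheory Filter
open scoped ENNReal NNReal

noncomputable section

namespace TensorPCA

/-- Real `d`-way tensors of size `N 0 × ⋯ × N (d - 1)`. -/
abbrev Tensor {d : ℕ} (N : Fin d → ℕ) : Type := (∀ k, Fin (N k)) → ℝ

/-- The mode-`j` unfolding: the rows are indexed by the `j`-th index, the columns by the
tuple of the remaining indices (the order of the columns plays no role). -/
def unfold {d : ℕ} {N : Fin d → ℕ} (Y : Tensor N) (j : Fin d) :
    Matrix (Fin (N j)) (∀ k : {k // k ≠ j}, Fin (N k)) ℝ :=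
  Matrix.of fun a b => Y ((Equiv.piSplitAt j fun k => Fin (N k)).symm (a, b))

/-- Families `v j r ∈ ℝ^(N j)` of loadings/factors, `r` ranging over `R` factors. -/
abbrev Loadings {d : ℕ} (N : Fin d → ℕ) (R : ℕ) : Type :=
  ∀ j : Fin d, Fin R → EuclideanSpace ℝ (Fin (N j))

section Model

variable {d : ℕ} {N : Fin d → ℕ} {R : ℕ}

/-- The `N j × R` matrix `V_j = (v_{j,1}, …, v_{j,R})`. -/
def loadingMatrix (v : Loadings N R) (j : Fin d) : Matrix (Fin (N j)) (Fin R) ℝ :=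
  Matrix.of fun i r => v j r i

/-- The loadings/factors are nonzero and orthogonal: every `V_jᵀ V_j` is diagonal. -/
structure IsOrthogonal (v : Loadings N R) : Prop where
  ne_zero : ∀ j r, v j r ≠ 0
  isDiag : ∀ j, ((loadingMatrix v j).transpose * loadingMatrix v j).IsDiag

/-- Normalized loadings/factors `m_{j,r} = v_{j,r} / ‖v_{j,r}‖`. -/
def normalized (v : Loadings N R) (j : Fin d) (r : Fin R) : EuclideanSpace ℝ (Fin (N j)) :=
  ‖v j r‖⁻¹ • v j r

/-- Scale components `σ_r = ∏ j, ‖v_{j,r}‖`. -/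
def scale (v : Loadings N R) (r : Fin R) : ℝ := ∏ j, ‖v j r‖

/-- The scale components, extended by `σ_k = 0` beyond the `R` factors. -/
def scaleExt (v : Loadings N R) (k : ℕ) : ℝ :=
  if h : k < R then scale v ⟨k, h⟩ else 0

/-- `D = diag(σ_1, …, σ_R)`. -/
def scaleMatrix (v : Loadings N R) : Matrix (Fin R) (Fin R) ℝ := Matrix.diagonal (scale v)

/-- The gap `δ_r = min_{k ≠ r} |σ_k² - σ_r²|`, over all `k`, with `σ_k = 0` beyond the `R`
factors (only finitely many values occur, so the infimum is a minimum). -/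
def gap (v : Loadings N R) (r : Fin R) : ℝ :=
  ⨅ k : {k : ℕ // k ≠ (r : ℕ)}, |scaleExt v k ^ 2 - scaleExt v r ^ 2|

/-- The tensor factor model `Y = ∑ r, ⨂ j, v_{j,r} + U`. -/
def observed (v : Loadings N R) (U : Tensor N) : Tensor N :=
  fun i => (∑ r, ∏ j, v j r (i j)) + U i

end Model

/-- `x` is a unit eigenvector of the symmetric matrix `A` for its `(k + 1)`-th largest
eigenvalue, counted with multiplicity (`eigenvalues₀` is sorted in decreasing order). -/
structure IsUnitEigenvector {n : ℕ} (A : Matrix (Fin n) (Fin n) ℝ) (k : ℕ)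
    (x : EuclideanSpace ℝ (Fin n)) : Prop where
  norm_eq : ‖x‖ = 1
  eigen : ∃ (hA : A.IsHermitian) (hk : k < Fintype.card (Fin n)),
    A.mulVec x.ofLp = hA.eigenvalues₀ ⟨k, hk⟩ • x.ofLp

/-- `mhat` is the PCA estimate of `m_{j,r}` from the data `Y`: a unit eigenvector of
`Y_(j) Y_(j)ᵀ` for the `r`-th largest eigenvalue, whose sign is chosen so that it has a
nonnegative inner product with `m_{j,r}`. -/
structure IsPCAEstimate {d : ℕ} {N : Fin d → ℕ} {R : ℕ} (v : Loadings N R) (Y : Tensor N)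
    (j : Fin d) (r : Fin R) (mhat : EuclideanSpace ℝ (Fin (N j))) : Prop where
  eigenvector : IsUnitEigenvector (unfold Y j * (unfold Y j).transpose) r mhat
  sign : 0 ≤ inner ℝ mhat (normalized v j r)

/-- The entries of the random tensor `U` are independent with common law `ν`. -/
structure IsIIDNoise {Ω : Type*} [MeasurableSpace Ω] {d : ℕ} {N : Fin d → ℕ}
    (U : Ω → Tensor N) (ν : Measure ℝ) (P : Measure Ω) : Prop where
  law : ∀ i, HasLaw (fun ω => U ω i) ν P
  indep : iIndepFun (fun i ω => U ω i) P

/-- `X = O_P(a)` along the filter `l`: for every `η > 0` there is a constant `C < ∞` such that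
eventually `P(‖X_n‖ > C a_n) ≤ η`. -/
def IsBigOP {ι : Type*} {Ω : ι → Type*} [∀ n, MeasurableSpace (Ω n)] {E : ι → Type*}
    [∀ n, NormedAddCommGroup (E n)] (P : ∀ n, Measure (Ω n)) (l : Filter ι)
    (X : ∀ n, Ω n → E n) (a : ι → ℝ≥0∞) : Prop :=
  ∀ η : ℝ≥0∞, 0 < η → ∃ C : ℝ≥0, ∀ᶠ n in l, P n {ω | (C : ℝ≥0∞) * a n < ‖X n ω‖ₑ} ≤ η

/-- The rate `(√N_j trace(D) + max(N_j, ∏_{k ≠ j} N_k)) / δ_r`; it is `∞` if `δ_r = 0`. -/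
def rate {d : ℕ} {N : Fin d → ℕ} {R : ℕ} (v : Loadings N R) (j : Fin d) (r : Fin R) : ℝ≥0∞ :=
  ENNReal.ofReal (√(N j : ℝ) * (scaleMatrix v).trace +
    max (N j : ℝ) (∏ k ∈ Finset.univ.erase j, (N k : ℝ))) / ENNReal.ofReal (gap v r)

end TensorPCA

end

/-! The unfolded signal is `L = ∑ σ_r m_r w_rᵀ`, where `w_r` is the Kronecker product of the unit
loadings of the other modes. Both families are orthonormal (the `w_r` because `d ≥ 2`), so `L Lᵀ`
has eigenpairs `(σ_r², m_r)` and vanishes on the complement. Noise `Z` changes the Gram matrix by `Z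
Lᵀ + L Zᵀ + Z Zᵀ`, of norm at most `2 ∑ σ_r ‖Z w_r‖ + ‖Z‖²`. By Weyl's inequality the estimate is
then an approximate eigenvector of `L Lᵀ` for `σ_r²`, and a Davis–Kahan argument divides the error
by the gap (`norm_sub_normalized_mul_gap_le`).

The size of `‖Z w_r‖` is `√N_j` by a second moment computation (`measure_norm_mulVec_sq_gt_le`). The
hard part is that `‖Z‖²` is of the order of the larger dimension `N` (`exists_opNorm_sq_bound`).
Entries are truncated at a level of order `√(N/k)` with `k` of order `log N`; the moment of order `4
+ ε` makes this harmless. The expectation of `tr (A Aᵀ)^k` then reduces to closed walks that use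
every edge at least twice.

These walks are counted by comparison. A walk visits at most one vertex more than it uses edges, so
the weight `K⁻²` gained per edge can be moved to the vertices. Weighted in this way, the walks on
large index sets are no more numerous than those on `Fin (2 * k)` (`sum_recurrent_weighted_le`). The
latter are counted by a random `2k × 2k` matrix with a centred law whose moments of order at least
two are at least one: each such walk adds at least one to the expected trace (`card_recurrent_le`).
That trace is bounded through the operator norm, by subgaussian estimates and averaging over the
unit ball. Since the dimension matches the order of the moment, losses exponential in the dimension
only cost a constant after taking roots. -/

namespace TensorPCA

/-! ### Closed bipartite walks and their comparison across index sets. -/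

section WalkComparison

/-- Row positions of the two edges used at each step of a bipartite walk. -/
def stepRow (k : ℕ) : Fin k ⊕ Fin k → Fin (k + 1) := Sum.elim Fin.castSucc Fin.succ

/-- Column positions of the two edges used at each step of a bipartite walk. -/
def stepCol (k : ℕ) : Fin k ⊕ Fin k → Fin k := Sum.elim id id

/-- The sequence of edges of the bipartite walk `i₀ j₀ i₁ j₁ ⋯ iₖ`. -/
def walkEdge {k : ℕ} {α β : Type*} (i : Fin (k + 1) → α) (j : Fin k → β)
    (t : Fin k ⊕ Fin k) : α × β := (i (stepRow k t), j (stepCol k t))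

/-- The walks with given kernels are closed and use every edge at least twice. -/
def IsRecurrent {k : ℕ} (π : Setoid (Fin (k + 1))) (ρ : Setoid (Fin k)) : Prop :=
  π 0 (Fin.last k) ∧ ∀ t, ∃ t', t' ≠ t ∧ π (stepRow k t') (stepRow k t) ∧
    ρ (stepCol k t') (stepCol k t)

lemma isRecurrent_ker_iff {k : ℕ} {α β : Type*} (i : Fin (k + 1) → α) (j : Fin k → β) :
    IsRecurrent (Setoid.ker i) (Setoid.ker j) ↔
      i 0 = i (Fin.last k) ∧ ∀ t, ∃ t', t' ≠ t ∧ walkEdge i j t' = walkEdge i j t := by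
  simp [IsRecurrent, walkEdge, Setoid.ker_def]

/-- Maps with a given kernel are the same as injections of the quotient. -/
def kerEquivEmbedding {τ α : Type*} (π : Setoid τ) :
    {i : τ → α // Setoid.ker i = π} ≃ (Quotient π ↪ α) where
  toFun i := ⟨Quotient.lift i.1 fun a b h => by
      have : Setoid.ker i.1 a b := by rw [i.2]; exact h
      exact this, by
    intro a b
    induction a using Quotient.inductionOn
    induction b using Quotient.inductionOn
    intro h
    refine Quotient.sound ?_
    have h' : Setoid.ker i.1 _ _ := h
    rw [i.2] at h'
    exact h'⟩
  invFun f := ⟨fun t => f (Quotient.mk π t), by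
    ext a b
    rw [Setoid.ker_def, f.injective.eq_iff, Quotient.eq]⟩
  left_inv i := by ext; rfl
  right_inv f := by
    ext a
    induction a using Quotient.inductionOn
    rfl

lemma card_filter_ker_eq {τ α : Type*} [Fintype τ] [Fintype α] [DecidableEq τ]
    (π : Setoid τ) [DecidablePred fun i : τ → α => Setoid.ker i = π] :
    (Finset.univ.filter fun i : τ → α => Setoid.ker i = π).card =
      (Fintype.card α).descFactorial (Nat.card (Quotient π)) := by
  classical
  let _ : Fintype (Quotient π) := Fintype.ofFinite _
  rw [← Fintype.card_subtype, Fintype.card_congr (kerEquivEmbedding π),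
    Fintype.card_embedding_eq, Nat.card_eq_fintype_card]

lemma card_image_eq_card_quotient_ker {τ α : Type*} [Fintype τ] [DecidableEq α] (i : τ → α) :
    (Finset.univ.image i).card = Nat.card (Quotient (Setoid.ker i)) := by
  rw [Nat.card_congr (Setoid.quotientKerEquivRange i), Nat.card_coe_set_eq,
    Set.ncard_eq_toFinset_card', Set.toFinset_range]

/-- Sums over maps `τ → α` weighted by `q` to the number of values are dominated by unweighted
sums over maps into a set `γ` of size about `q * #α`. -/
lemma sum_pow_card_image_mul_le {τ α γ : Type*} [Fintype τ] [Fintype α] [Fintype γ]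
    [DecidableEq τ] [DecidableEq α] (F : Setoid τ → ℝ) (hF : ∀ π, 0 ≤ F π) {q : ℝ} (hq : 0 ≤ q)
    (h : ∀ a ≤ Fintype.card τ,
      (q * Fintype.card α) ^ a ≤ ((Fintype.card γ).descFactorial a : ℝ)) :
    ∑ i : τ → α, q ^ (Finset.univ.image i).card * F (Setoid.ker i) ≤
      ∑ i : τ → γ, F (Setoid.ker i) := by
  classical
  have : Finite (Setoid τ) := Finite.of_injective (fun π : Setoid τ => (π : τ → τ → Prop))
    fun π ρ h => by ext a b; exact iff_of_eq (congrFun (congrFun h a) b)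
  let _ : Fintype (Setoid τ) := Fintype.ofFinite _
  -- The summands see a map only through its kernel, and the maps with a given kernel are counted by
  -- a descending factorial of the size of the target. So the two sums can be compared kernel by
  -- kernel.
  rw [← Finset.sum_fiberwise Finset.univ (fun i : τ → α => Setoid.ker i),
    ← Finset.sum_fiberwise Finset.univ (fun i : τ → γ => Setoid.ker i)]
  refine Finset.sum_le_sum fun π _ => ?_
  have h1 : ∀ i ∈ Finset.univ.filter (fun i : τ → α => Setoid.ker i = π),
      q ^ (Finset.univ.image i).card * F (Setoid.ker i) =
        q ^ (Nat.card (Quotient π)) * F π := by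
    intro i hi
    rw [Finset.mem_filter] at hi
    rw [card_image_eq_card_quotient_ker, hi.2]
  have h2 : ∀ i ∈ Finset.univ.filter (fun i : τ → γ => Setoid.ker i = π),
      F (Setoid.ker i) = F π := by
    intro i hi
    rw [Finset.mem_filter] at hi
    rw [hi.2]
  rw [Finset.sum_congr rfl h1, Finset.sum_congr rfl h2, Finset.sum_const, Finset.sum_const,
    card_filter_ker_eq, card_filter_ker_eq, nsmul_eq_mul, nsmul_eq_mul, ← mul_assoc]
  refine mul_le_mul_of_nonneg_right ?_ (hF π)
  have hc : Nat.card (Quotient π) ≤ Fintype.card τ := by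
    rw [← Nat.card_eq_fintype_card]
    exact Nat.card_le_card_of_surjective _ Quotient.mk_surjective
  refine le_trans ?_ (h _ hc)
  rw [mul_pow, mul_comm]
  refine mul_le_mul_of_nonneg_left ?_ (pow_nonneg hq _)
  exact_mod_cast Nat.descFactorial_le_pow _ _

/-- A connected walk visits at most one vertex more than it visits edges. -/
lemma card_image_add_card_image_le {k : ℕ} {α β : Type*} [DecidableEq α] [DecidableEq β]
    (i : Fin (k + 1) → α) (j : Fin k → β) :
    (Finset.univ.image i).card + (Finset.univ.image j).card ≤
      (Finset.univ.image (walkEdge i j)).card + 1 := by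
  induction k with
  | zero =>
    simp
  | succ k ih =>
    specialize ih (fun t => i t.castSucc) (fun t => j t.castSucc)
    set I := Finset.univ.image (fun t : Fin (k + 1) => i t.castSucc) with hI
    set J := Finset.univ.image (fun t : Fin k => j t.castSucc) with hJ
    set E := Finset.univ.image
      (walkEdge (fun t : Fin (k + 1) => i t.castSucc) (fun t : Fin k => j t.castSucc)) with hE
    have hI' : Finset.univ.image i = insert (i (Fin.last _)) I := by
      ext x
      simp [hI, Fin.exists_iff_castSucc, eq_comm]
    have hJ' : Finset.univ.image j = insert (j (Fin.last _)) J := by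
      ext x
      simp [hJ, Fin.exists_iff_castSucc, eq_comm]
    set x := i (Fin.last (k + 1))
    set x' := i (Fin.last k).castSucc
    set y := j (Fin.last k)
    have hx' : x' ∈ I := Finset.mem_image_of_mem _ (Finset.mem_univ _)
    have hEE : insert (x, y) (insert (x', y) E) ⊆ Finset.univ.image (walkEdge i j) := by
      intro e he
      simp only [Finset.mem_insert, hE, Finset.mem_image, Finset.mem_univ, true_and] at he ⊢
      rcases he with rfl | rfl | ⟨t, rfl⟩
      · exact ⟨Sum.inr (Fin.last k), rfl⟩
      · exact ⟨Sum.inl (Fin.last k), rfl⟩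
      · rcases t with t | t
        · exact ⟨Sum.inl t.castSucc, rfl⟩
        · exact ⟨Sum.inr t.castSucc, rfl⟩
    have hE1 : ∀ e ∈ E, e.1 ∈ I ∧ e.2 ∈ J := by
      intro e he
      simp only [hE, Finset.mem_image, Finset.mem_univ, true_and] at he
      obtain ⟨t, rfl⟩ := he
      exact ⟨Finset.mem_image_of_mem _ (Finset.mem_univ _),
        Finset.mem_image_of_mem _ (Finset.mem_univ _)⟩
    refine le_trans ?_ (Nat.add_le_add_right (Finset.card_le_card hEE) 1)
    rw [hI', hJ']
    -- A new column `y` makes the edge `(x', y)` new; below, a new row `x` makes `(x, y)` new, and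
    -- distinct from `(x', y)` because `x'` is an old row.
    have a1 : (insert y J).card + E.card ≤ J.card + (insert (x', y) E).card := by
      by_cases h : y ∈ J
      · rw [Finset.insert_eq_of_mem h]
        have := Finset.card_le_card (Finset.subset_insert (x', y) E)
        omega
      · rw [Finset.card_insert_of_notMem h,
          Finset.card_insert_of_notMem fun h' => h (hE1 _ h').2]
        omega
    have a2 : (insert x I).card + (insert (x', y) E).card ≤
        I.card + (insert (x, y) (insert (x', y) E)).card := by
      by_cases h : x ∈ I
      · rw [Finset.insert_eq_of_mem h]
        have := Finset.card_le_card (Finset.subset_insert (x, y) (insert (x', y) E))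
        omega
      · rw [Finset.card_insert_of_notMem h,
          Finset.card_insert_of_notMem (a := (x, y)) (s := insert (x', y) E)]
        · omega
        · rw [Finset.mem_insert]
          rintro (h' | h')
          · have h2 : x = x' := congrArg Prod.fst h'
            exact h (by rw [h2]; exact hx')
          · exact h (hE1 _ h').1
    omega

open Classical in
/-- Comparison of the weighted number of recurrent walks in `α × β` with the number of recurrent
walks in `Fin (2 * k) × Fin (2 * k)`. -/
lemma sum_recurrent_weighted_le {k : ℕ} {α β : Type*} [Fintype α] [Fintype β]
    [DecidableEq α] [DecidableEq β]
    {q : ℝ} (hq : 0 ≤ q) (hα : q * Fintype.card α ≤ k) (hβ : q * Fintype.card β ≤ k) :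
    ∑ i : Fin (k + 1) → α, ∑ j : Fin k → β,
      q ^ ((Finset.univ.image i).card + (Finset.univ.image j).card) *
        (if IsRecurrent (Setoid.ker i) (Setoid.ker j) then 1 else 0) ≤
    ∑ i : Fin (k + 1) → Fin (2 * k), ∑ j : Fin k → Fin (2 * k),
        (if IsRecurrent (Setoid.ker i) (Setoid.ker j) then (1 : ℝ) else 0) := by
  have key : ∀ (x : ℝ), 0 ≤ x → x ≤ k → ∀ a ≤ k + 1,
      x ^ a ≤ ((Fintype.card (Fin (2 * k))).descFactorial a : ℝ) := by
    intro x hx0 hx a ha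
    rw [Fintype.card_fin]
    calc x ^ a ≤ (k : ℝ) ^ a := pow_le_pow_left₀ hx0 hx a
      _ ≤ ((2 * k + 1 - a : ℕ) : ℝ) ^ a := by
          -- At most `k + 1` values occur, so each factor of the descending factorial of `2 * k` is
          -- at least `2 * k + 1 - a ≥ k`; this is why the comparison set has size `2 * k`.
          refine pow_le_pow_left₀ (by positivity) ?_ a
          exact_mod_cast (by omega : k ≤ 2 * k + 1 - a)
      _ ≤ _ := by exact_mod_cast Nat.pow_sub_le_descFactorial _ _
  calc _ = ∑ i : Fin (k + 1) → α, q ^ (Finset.univ.image i).card *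
        (∑ j : Fin k → β, q ^ (Finset.univ.image j).card *
          (if IsRecurrent (Setoid.ker i) (Setoid.ker j) then (1 : ℝ) else 0)) := by
        refine Finset.sum_congr rfl fun i _ => ?_
        rw [Finset.mul_sum]
        refine Finset.sum_congr rfl fun j _ => ?_
        rw [pow_add, mul_assoc]
    _ ≤ ∑ i : Fin (k + 1) → α, q ^ (Finset.univ.image i).card *
        (∑ j : Fin k → Fin (2 * k),
          (if IsRecurrent (Setoid.ker i) (Setoid.ker j) then (1 : ℝ) else 0)) := by
        refine Finset.sum_le_sum fun i _ => mul_le_mul_of_nonneg_left ?_ (pow_nonneg hq _)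
        refine sum_pow_card_image_mul_le
          (fun ρ => if IsRecurrent (Setoid.ker i) ρ then (1 : ℝ) else 0)
          (fun ρ => by positivity) hq fun a ha => ?_
        rw [Fintype.card_fin] at ha
        exact key _ (by positivity) hβ a (by omega)
    _ ≤ _ := by
        refine sum_pow_card_image_mul_le
          (fun π => ∑ j : Fin k → Fin (2 * k),
            if IsRecurrent π (Setoid.ker j) then (1 : ℝ) else 0)
          (fun π => by positivity) hq fun a ha => ?_
        rw [Fintype.card_fin] at ha
        exact key _ (by positivity) hα a ha

end WalkComparison

/-! ### The trace of a power of a Gram matrix as a sum over closed walks. -/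

section TraceExpansion

lemma pow_apply_eq_sum_paths {α : Type*} [Fintype α] [DecidableEq α] (M : Matrix α α ℝ) (k : ℕ) (x y : α) :
    (M ^ k) x y = ∑ i : Fin (k + 1) → α, if i 0 = x ∧ i (Fin.last k) = y then
      ∏ t : Fin k, M (i t.castSucc) (i t.succ) else 0 := by
  induction k generalizing x with
  | zero =>
    rw [pow_zero, Matrix.one_apply, ← (Equiv.funUnique (Fin 1) α).symm.sum_comp]
    by_cases h : x = y
    · subst h; simp [Equiv.funUnique]
    · rw [if_neg h]
      symm
      refine Finset.sum_eq_zero fun z _ => if_neg ?_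
      rintro ⟨h1, h2⟩
      exact h (h1.symm.trans h2)
  | succ k ih =>
    rw [pow_succ', Matrix.mul_apply, ← (Fin.consEquiv fun _ => α).sum_comp,
      Fintype.sum_prod_type]
    have h1 : ∀ (a : α) (i : Fin (k + 1) → α),
        (if (Fin.consEquiv fun _ => α) (a, i) 0 = x ∧
            (Fin.consEquiv fun _ => α) (a, i) (Fin.last (k + 1)) = y then
          ∏ t : Fin (k + 1), M ((Fin.consEquiv fun _ => α) (a, i) t.castSucc)
            ((Fin.consEquiv fun _ => α) (a, i) t.succ) else 0) =
        if a = x then (if i (Fin.last k) = y then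
          M x (i 0) * ∏ t : Fin k, M (i t.castSucc) (i t.succ) else 0) else 0 := by
      intro a i
      have e0 : (Fin.consEquiv fun _ => α) (a, i) 0 = a := rfl
      have es : ∀ t : Fin (k + 1), (Fin.consEquiv fun _ => α) (a, i) t.succ = i t := fun t => rfl
      rw [e0, ← Fin.succ_last, es, Fin.prod_univ_succ]
      by_cases ha : a = x
      · subst ha
        simp only [true_and, if_true, es]
        rfl
      · simp [ha]
    simp_rw [h1]
    rw [Finset.sum_comm]
    simp_rw [Finset.sum_ite_eq' Finset.univ x, Finset.mem_univ, if_true]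
    calc ∑ z, M x z * (M ^ k) z y
        = ∑ z, ∑ i : Fin (k + 1) → α, if z = i 0 then (if i (Fin.last k) = y then
          M x (i 0) * ∏ t : Fin k, M (i t.castSucc) (i t.succ) else 0) else 0 := by
          refine Finset.sum_congr rfl fun z _ => ?_
          rw [ih, Finset.mul_sum]
          refine Finset.sum_congr rfl fun i _ => ?_
          by_cases hz : z = i 0
          · subst hz; simp
          · rw [if_neg hz, if_neg (fun h => hz h.1.symm), mul_zero]
      _ = _ := by
          rw [Finset.sum_comm]
          simp

lemma trace_mul_transpose_pow {α β : Type*} [Fintype α] [Fintype β] [DecidableEq α]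
    (A : Matrix α β ℝ) (k : ℕ) :
    ((A * A.transpose) ^ k).trace = ∑ i : Fin (k + 1) → α, ∑ j : Fin k → β,
      if i 0 = i (Fin.last k) then
        ∏ t : Fin k ⊕ Fin k, A (walkEdge i j t).1 (walkEdge i j t).2 else 0 := by
  simp_rw [Matrix.trace, Matrix.diag, pow_apply_eq_sum_paths]
  rw [Finset.sum_comm]
  refine Finset.sum_congr rfl fun i _ => ?_
  by_cases h : i 0 = i (Fin.last k)
  · simp only [← h, and_self, Finset.sum_ite_eq, Finset.mem_univ, if_true]
    simp_rw [Matrix.mul_apply, Matrix.transpose_apply]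
    rw [Finset.prod_univ_sum]
    simp only [Fintype.piFinset_univ]
    refine Finset.sum_congr rfl fun j _ => ?_
    rw [Fintype.prod_sum_type, ← Finset.prod_mul_distrib]
    rfl
  · simp only [if_neg h, Finset.sum_const_zero]
    refine Finset.sum_eq_zero fun x _ => if_neg ?_
    rintro ⟨h1, h2⟩
    exact h (h1.trans h2.symm)

end TraceExpansion

/-! ### The three point law: lower bounds on moments and subgaussian upper bounds. -/

section ThreePoint

/-- The values of a centred three point law whose moments of order at least two are at least
one. -/
noncomputable def threePoint : Fin 3 → ℝ := ![2, -1, -1]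

lemma sum_threePoint_pow (m : ℕ) : ∑ c, threePoint c ^ m = 2 ^ m + 2 * (-1) ^ m := by
  simp [threePoint, Fin.sum_univ_three]; ring

lemma sum_threePoint_pow_nonneg (m : ℕ) : 0 ≤ ∑ c, threePoint c ^ m := by
  rw [sum_threePoint_pow]
  rcases m with _ | m
  · norm_num
  · have h : (1 : ℝ) ≤ 2 ^ m := one_le_pow₀ (by norm_num)
    have h' : |(-1 : ℝ) ^ (m + 1)| = 1 := by simp
    have := (abs_le.1 h'.le).1
    rw [pow_succ]
    linarith

/-- The asymmetry of the law matters here: for random signs the odd moments vanish, and walks with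
an edge of odd multiplicity would be missed by the count. -/
lemma three_le_sum_threePoint_pow {m : ℕ} (hm : m ≠ 1) : 3 ≤ ∑ c, threePoint c ^ m := by
  rw [sum_threePoint_pow]
  rcases m with _ | _ | _ | m
  · norm_num
  · exact absurd rfl hm
  · norm_num
  · have h : (1 : ℝ) ≤ 2 ^ m := one_le_pow₀ (by norm_num)
    have h' : |(-1 : ℝ) ^ (m + 1 + 1 + 1)| = 1 := by simp
    have := (abs_le.1 h'.le).1
    have h2 : (2 : ℝ) ^ (m + 1 + 1 + 1) = 8 * 2 ^ m := by ring
    linarith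

lemma sum_prod_threePoint_eq {τ β : Type*} [Fintype τ] [Fintype β] [DecidableEq β]
    (E : τ → β) :
    ∑ Y : β → Fin 3, ∏ t, threePoint (Y (E t)) =
      ∏ e : β, ∑ c, threePoint c ^ (Finset.univ.filter fun t => E t = e).card := by
  rw [Finset.prod_univ_sum]
  simp only [Fintype.piFinset_univ]
  refine Finset.sum_congr rfl fun Y _ => ?_
  rw [← Finset.prod_fiberwise Finset.univ E]
  refine Finset.prod_congr rfl fun e _ => ?_
  rw [← Finset.prod_const]
  refine Finset.prod_congr rfl fun t ht => ?_
  rw [(Finset.mem_filter.1 ht).2]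

lemma sum_prod_threePoint_nonneg {τ β : Type*} [Fintype τ] [Fintype β] [DecidableEq β] (E : τ → β) :
    0 ≤ ∑ Y : β → Fin 3, ∏ t, threePoint (Y (E t)) := by
  rw [sum_prod_threePoint_eq]
  exact Finset.prod_nonneg fun e _ => sum_threePoint_pow_nonneg _

lemma card_fiber_ne_one {τ β : Type*} [Fintype τ] [DecidableEq β] {E : τ → β}
    (h : ∀ t, ∃ t', t' ≠ t ∧ E t' = E t) (e : β) :
    (Finset.univ.filter fun t => E t = e).card ≠ 1 := by
  intro h1
  obtain ⟨t, ht⟩ := Finset.card_eq_one.1 h1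
  have hte : E t = e := by
    have : t ∈ Finset.univ.filter fun t => E t = e := by rw [ht]; simp
    exact (Finset.mem_filter.1 this).2
  obtain ⟨t', h1, h2⟩ := h t
  have : t' ∈ Finset.univ.filter fun t => E t = e := by simp [h2, hte]
  rw [ht, Finset.mem_singleton] at this
  exact h1 this

lemma le_sum_prod_threePoint {τ β : Type*} [Fintype τ] [Fintype β] [DecidableEq β] {E : τ → β}
    (h : ∀ t, ∃ t', t' ≠ t ∧ E t' = E t) :
    3 ^ Fintype.card β ≤ ∑ Y : β → Fin 3, ∏ t, threePoint (Y (E t)) := by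
  rw [sum_prod_threePoint_eq, ← Finset.card_univ, ← Finset.prod_const]
  exact Finset.prod_le_prod (fun _ _ => by norm_num) fun e _ =>
    three_le_sum_threePoint_pow (card_fiber_ne_one h e)

/-- For small `u` the linear terms cancel because the law is centred, and `|exp x - 1 - x| ≤ x ^ 2`
leaves `3 + 6 * u ^ 2`. For large `u` each exponent is already at most `4 * u ^ 2`. -/
lemma sum_exp_mul_threePoint_le (u : ℝ) :
    ∑ c, Real.exp (u * threePoint c) ≤ 3 * Real.exp (4 * u ^ 2) := by
  simp only [threePoint, Fin.sum_univ_three]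
  simp only [Matrix.cons_val_zero, Matrix.cons_val_one, Matrix.cons_val]
  rcases le_or_gt |u| (1 / 2) with h | h
  · have h1 := Real.abs_exp_sub_one_sub_id_le (x := u * 2) (by rw [abs_mul, abs_two]; linarith)
    have h2 := Real.abs_exp_sub_one_sub_id_le (x := u * -1) (by
      rw [abs_mul, abs_neg, abs_one]; linarith)
    have h3 := Real.add_one_le_exp (4 * u ^ 2)
    nlinarith [(abs_le.1 h1).2, (abs_le.1 h2).2]
  · have h1 : 2 * |u| ≤ 4 * u ^ 2 := by rw [← sq_abs u]; nlinarith
    have h2 : Real.exp (u * 2) ≤ Real.exp (4 * u ^ 2) :=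
      Real.exp_le_exp.2 (by linarith [le_abs_self u])
    have h3 : Real.exp (u * -1) ≤ Real.exp (4 * u ^ 2) :=
      Real.exp_le_exp.2 (by linarith [neg_abs_le u, abs_nonneg u])
    linarith

lemma sum_exp_sum_threePoint_le {β : Type*} [Fintype β] [DecidableEq β] (a : β → ℝ) :
    ∑ Y : β → Fin 3, Real.exp (∑ e, a e * threePoint (Y e)) ≤
      3 ^ Fintype.card β * Real.exp (4 * ∑ e, a e ^ 2) := by
  calc ∑ Y : β → Fin 3, Real.exp (∑ e, a e * threePoint (Y e))
      = ∏ e : β, ∑ c, Real.exp (a e * threePoint c) := by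
        rw [Finset.prod_univ_sum]
        simp only [Fintype.piFinset_univ, Real.exp_sum]
    _ ≤ ∏ e : β, (3 * Real.exp (4 * a e ^ 2)) :=
        Finset.prod_le_prod (fun e _ => by positivity) fun e _ => sum_exp_mul_threePoint_le _
    _ = _ := by
        rw [Finset.prod_mul_distrib, Finset.prod_const, Finset.card_univ, ← Real.exp_sum,
          ← Finset.mul_sum]

/-- Khintchine type inequality for the three point law. -/
lemma sum_pow_sum_threePoint_le {β : Type*} [Fintype β] [DecidableEq β] (a : β → ℝ) {k : ℕ} (hk : k ≠ 0) :
    ∑ Y : β → Fin 3, (∑ e, a e * threePoint (Y e)) ^ (2 * k) ≤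
      3 ^ Fintype.card β * (2 * (4 * Real.exp 4 * k * ∑ e, a e ^ 2) ^ k) := by
  set s := ∑ e, a e ^ 2 with hs
  have hs0 : 0 ≤ s := Finset.sum_nonneg fun e _ => sq_nonneg _
  have hk0 : (0 : ℝ) < k := by positivity
  rcases hs0.eq_or_lt with h | h
  · have ha : ∀ e, a e = 0 := fun e => by
      have := (Finset.sum_eq_zero_iff_of_nonneg fun e _ => sq_nonneg (a e)).1 h.symm e
        (Finset.mem_univ e)
      exact pow_eq_zero_iff (two_ne_zero) |>.1 this
    simp [ha, hk, ← h]
  -- With this `t` the exponent `4 * t ^ 2 * s` of the exponential moment equals `4 * k`, so it only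
  -- contributes a constant `exp 4` inside the `k`-th power.
  set t := √(k / s) with ht
  have ht2 : t ^ 2 = k / s := Real.sq_sqrt (by positivity)
  have ht0 : 0 < t := Real.sqrt_pos.2 (by positivity)
  have key : ∀ S : ℝ, S ^ (2 * k) ≤
      (2 * k).factorial * (s / k) ^ k * (Real.exp (t * S) + Real.exp (-t * S)) := by
    intro S
    have h1 := Real.pow_div_factorial_le_exp (x := |t * S|) (hx := abs_nonneg _) (n := 2 * k)
    have h2 : Real.exp |t * S| ≤ Real.exp (t * S) + Real.exp (-t * S) := by
      rcases abs_cases (t * S) with h | h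
      · rw [h.1]; linarith [Real.exp_pos (-t * S)]
      · rw [h.1, neg_mul]; linarith [Real.exp_pos (t * S)]
    have h3 : |t * S| ^ (2 * k) = (k / s) ^ k * S ^ (2 * k) := by
      rw [pow_mul, sq_abs, mul_pow, ht2, mul_pow, pow_mul]
    rw [h3, div_le_iff₀ (by positivity)] at h1
    calc S ^ (2 * k) = (s / k) ^ k * ((k / s) ^ k * S ^ (2 * k)) := by
          rw [← mul_assoc, ← mul_pow, div_mul_div_cancel₀ hk0.ne', div_self h.ne', one_pow, one_mul]
      _ ≤ (s / k) ^ k * ((Real.exp (t * S) + Real.exp (-t * S)) * (2 * k).factorial) := by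
          refine mul_le_mul_of_nonneg_left (h1.trans ?_) (by positivity)
          exact mul_le_mul_of_nonneg_right h2 (by positivity)
      _ = _ := by ring
  have hexp : ∀ t' : ℝ, t' ^ 2 = k / s →
      ∑ Y : β → Fin 3, Real.exp (t' * ∑ e, a e * threePoint (Y e)) ≤
        3 ^ Fintype.card β * Real.exp (4 * k) := by
    intro t' ht'
    have := sum_exp_sum_threePoint_le fun e => t' * a e
    simp_rw [mul_pow, ← Finset.mul_sum, ht', mul_assoc, ← Finset.mul_sum] at this
    rwa [← hs, div_mul_cancel₀ _ h.ne'] at this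
  have hfac : ((2 * k).factorial : ℝ) ≤ (4 * (k : ℝ) ^ 2) ^ k := by
    have : ((2 * k).factorial : ℝ) ≤ ((2 * k : ℕ) : ℝ) ^ (2 * k) := by
      exact_mod_cast Nat.factorial_le_pow _
    refine this.trans (le_of_eq ?_)
    rw [pow_mul]; push_cast; ring
  calc ∑ Y : β → Fin 3, (∑ e, a e * threePoint (Y e)) ^ (2 * k)
      ≤ ∑ Y : β → Fin 3, (2 * k).factorial * (s / k) ^ k *
        (Real.exp (t * ∑ e, a e * threePoint (Y e)) +
          Real.exp (-t * ∑ e, a e * threePoint (Y e))) :=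
        Finset.sum_le_sum fun Y _ => key _
    _ ≤ (2 * k).factorial * (s / k) ^ k * (3 ^ Fintype.card β * Real.exp (4 * k) +
          3 ^ Fintype.card β * Real.exp (4 * k)) := by
        rw [← Finset.mul_sum, Finset.sum_add_distrib]
        exact mul_le_mul_of_nonneg_left
          (add_le_add (hexp _ ht2) (hexp _ (by rw [neg_sq, ht2]))) (by positivity)
    _ ≤ (4 * (k : ℝ) ^ 2) ^ k * (s / k) ^ k * (3 ^ Fintype.card β * Real.exp (4 * k) +
          3 ^ Fintype.card β * Real.exp (4 * k)) := by gcongr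
    _ = _ := by
        rw [← mul_pow, mul_comm (4 : ℝ) (k : ℝ), Real.exp_nat_mul]
        have e1 : 4 * (k : ℝ) ^ 2 * (s / k) = 4 * k * s := by field_simp
        rw [e1]
        simp only [mul_pow]
        ring

end ThreePoint

/-! ### Averages over the unit ball in place of suprema. -/

section BallMoments

variable {r : ℕ}

lemma integrableOn_unitBall {f : EuclideanSpace ℝ (Fin r) → ℝ} (hf : Continuous f) :
    IntegrableOn f (Metric.closedBall 0 1) :=
  hf.continuousOn.integrableOn_compact (isCompact_closedBall _ _)

/-- The ball of radius `1 / 4` about `(3 / 4) w / ‖w‖` lies in the unit ball, and on it the inner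
product with `w` is at least `‖w‖ / 2`. The average thus replaces the maximum at a cost exponential
in `r`, much like a net argument. -/
lemma le_integral_unitBall_inner_pow (w : EuclideanSpace ℝ (Fin r)) (k : ℕ) :
    volume.real (Metric.closedBall (0 : EuclideanSpace ℝ (Fin r)) 1) * (1 / 4) ^ r *
        (1 / 4) ^ k * ‖w‖ ^ (2 * k) ≤
      ∫ y in Metric.closedBall (0 : EuclideanSpace ℝ (Fin r)) 1, inner ℝ w y ^ (2 * k) := by
  have hev : ∀ x : ℝ, 0 ≤ x ^ (2 * k) := fun x => (even_two_mul k).pow_nonneg x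
  rcases eq_or_ne w 0 with rfl | hw
  · rcases k with _ | k
    · simp only [mul_zero, pow_zero, mul_one, integral_const, smul_eq_mul, measureReal_restrict_apply_univ]
      exact mul_le_of_le_one_right measureReal_nonneg (pow_le_one₀ (by norm_num) (by norm_num))
    · rw [norm_zero, zero_pow (by omega), mul_zero]
      exact integral_nonneg fun y => hev _
  have hw0 : 0 < ‖w‖ := norm_pos_iff.2 hw
  set c : EuclideanSpace ℝ (Fin r) := (3 / 4 * ‖w‖⁻¹) • w with hc
  have hcn : ‖c‖ = 3 / 4 := by
    rw [hc, norm_smul, Real.norm_of_nonneg (by positivity), mul_assoc, inv_mul_cancel₀ hw0.ne',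
      mul_one]
  have hsub : Metric.closedBall c (1 / 4) ⊆ Metric.closedBall 0 1 := by
    refine Metric.closedBall_subset_closedBall' ?_
    rw [dist_zero_right, hcn]; norm_num
  have hcont : Continuous fun y : EuclideanSpace ℝ (Fin r) => inner ℝ w y ^ (2 * k) := by fun_prop
  have hvol : volume.real (Metric.closedBall c (1 / 4)) =
      (1 / 4) ^ r * volume.real (Metric.closedBall (0 : EuclideanSpace ℝ (Fin r)) 1) := by
    rw [Measure.addHaar_real_closedBall' _ _ (by norm_num)]
    simp
  calc _ = ∫ y in Metric.closedBall c (1 / 4), (‖w‖ / 2) ^ (2 * k) := by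
        have : (‖w‖ / 2) ^ (2 * k) = (1 / 4) ^ k * ‖w‖ ^ (2 * k) := by
          rw [pow_mul, pow_mul, ← mul_pow]; congr 1; ring
        rw [setIntegral_const, hvol, smul_eq_mul, this]
        ring
    _ ≤ ∫ y in Metric.closedBall c (1 / 4), inner ℝ w y ^ (2 * k) := by
        refine setIntegral_mono_on ?_ ?_ measurableSet_closedBall fun y hy => ?_
        · exact integrableOn_const (measure_closedBall_lt_top.ne)
        · exact (integrableOn_unitBall hcont).mono_set hsub
        · refine pow_le_pow_left₀ (by positivity) ?_ _
          have h1 : inner ℝ w y = inner ℝ w c + inner ℝ w (y - c) := by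
            rw [← inner_add_right, add_sub_cancel]
          have h2 : inner ℝ w c = 3 / 4 * ‖w‖ := by
            rw [hc, inner_smul_right, real_inner_self_eq_norm_sq]
            field_simp
          have h3 := abs_le.1 (abs_real_inner_le_norm w (y - c))
          have h4 : ‖y - c‖ ≤ 1 / 4 := by rwa [← dist_eq_norm]
          nlinarith [h3.1]
    _ ≤ _ := setIntegral_mono_set (integrableOn_unitBall hcont)
        (Eventually.of_forall fun y => hev _) hsub.eventuallyLE

lemma continuous_integral_unitBall_inner_pow
    (T : EuclideanSpace ℝ (Fin r) →L[ℝ] EuclideanSpace ℝ (Fin r)) (k : ℕ) :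
    Continuous fun x => ∫ y in Metric.closedBall (0 : EuclideanSpace ℝ (Fin r)) 1,
      inner ℝ x (T y) ^ (2 * k) :=
  continuous_parametric_integral_of_continuous
    (f := fun x y : EuclideanSpace ℝ (Fin r) => inner ℝ x (T y) ^ (2 * k))
    (by fun_prop) (isCompact_closedBall _ _)

/-- The one-vector estimate is used twice: first for `T v`, where `⟨T v, x⟩ = ⟨v, T* x⟩ ≤ ‖T* x‖`
removes `v`, then for `T* x`. -/
lemma norm_pow_le_integral_unitBall
    (T : EuclideanSpace ℝ (Fin r) →L[ℝ] EuclideanSpace ℝ (Fin r)) (k : ℕ)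
    {v : EuclideanSpace ℝ (Fin r)} (hv : ‖v‖ ≤ 1) :
    (volume.real (Metric.closedBall (0 : EuclideanSpace ℝ (Fin r)) 1) * (1 / 4) ^ r *
        (1 / 4) ^ k) ^ 2 * ‖T v‖ ^ (2 * k) ≤
      ∫ x in Metric.closedBall (0 : EuclideanSpace ℝ (Fin r)) 1,
        ∫ y in Metric.closedBall (0 : EuclideanSpace ℝ (Fin r)) 1,
          inner ℝ x (T y) ^ (2 * k) := by
  set c := volume.real (Metric.closedBall (0 : EuclideanSpace ℝ (Fin r)) 1) * (1 / 4) ^ r *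
        (1 / 4) ^ k with hc
  have hc0 : 0 ≤ c := by positivity
  calc c ^ 2 * ‖T v‖ ^ (2 * k) = c * (c * ‖T v‖ ^ (2 * k)) := by ring
    _ ≤ c * ∫ x in Metric.closedBall (0 : EuclideanSpace ℝ (Fin r)) 1,
          inner ℝ (T v) x ^ (2 * k) :=
        mul_le_mul_of_nonneg_left (le_integral_unitBall_inner_pow _ _) hc0
    _ = ∫ x in Metric.closedBall (0 : EuclideanSpace ℝ (Fin r)) 1,
          c * inner ℝ (T v) x ^ (2 * k) := (integral_const_mul _ _).symm
    _ ≤ _ := by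
        refine setIntegral_mono_on (integrableOn_unitBall (by fun_prop))
          (integrableOn_unitBall (continuous_integral_unitBall_inner_pow T k))
          measurableSet_closedBall fun x _ => ?_
        have h1 : |inner ℝ (T v) x| ≤ ‖T.adjoint x‖ := by
          rw [real_inner_comm, ← ContinuousLinearMap.adjoint_inner_left]
          refine (abs_real_inner_le_norm _ _).trans ?_
          exact mul_le_of_le_one_right (norm_nonneg _) hv
        calc c * inner ℝ (T v) x ^ (2 * k) ≤ c * ‖T.adjoint x‖ ^ (2 * k) := by
              refine mul_le_mul_of_nonneg_left ?_ hc0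
              rw [← (even_two_mul k).pow_abs]
              exact pow_le_pow_left₀ (abs_nonneg _) h1 _
          _ ≤ _ := le_integral_unitBall_inner_pow _ _
          _ = _ := by simp_rw [ContinuousLinearMap.adjoint_inner_left]

end BallMoments

/-! ### Operator norm, Frobenius norm and traces of powers. -/

section OperatorNorm

open scoped Matrix.Norms.L2Operator

lemma norm_mulVec_le {α β : Type*} [Fintype α] [Fintype β] [DecidableEq β]
    (M : Matrix α β ℝ) (x : EuclideanSpace ℝ β) :
    ‖(WithLp.toLp 2 (M.mulVec x.ofLp) : EuclideanSpace ℝ α)‖ ≤ ‖M‖ * ‖x‖ :=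
  Matrix.l2_opNorm_mulVec M x

lemma opNorm_le_of_forall {α β : Type*} [Fintype α] [Fintype β] [DecidableEq β]
    (M : Matrix α β ℝ) {c : ℝ} (hc : 0 ≤ c)
    (h : ∀ x : EuclideanSpace ℝ β,
      ‖(WithLp.toLp 2 (M.mulVec x.ofLp) : EuclideanSpace ℝ α)‖ ≤ c * ‖x‖) : ‖M‖ ≤ c := by
  rw [Matrix.l2_opNorm_def]
  exact ContinuousLinearMap.opNorm_le_bound _ hc h

/-- The operator norm is at most the Frobenius norm. -/
lemma opNorm_sq_le_sum_sq {α β : Type*} [Fintype α] [Fintype β] [DecidableEq β]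
    (M : Matrix α β ℝ) : ‖M‖ ^ 2 ≤ ∑ a, ∑ b, M a b ^ 2 := by
  have h0 : 0 ≤ ∑ a, ∑ b, M a b ^ 2 := by positivity
  refine (Real.le_sqrt (norm_nonneg _) h0).1 ?_
  refine opNorm_le_of_forall M (Real.sqrt_nonneg _) fun x => ?_
  rw [← Real.sqrt_sq (norm_nonneg x), ← Real.sqrt_mul h0, EuclideanSpace.norm_eq,
    EuclideanSpace.norm_sq_eq]
  refine Real.sqrt_le_sqrt ?_
  rw [Finset.sum_mul]
  refine Finset.sum_le_sum fun a _ => ?_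
  simp only [Real.norm_eq_abs, sq_abs]
  exact Finset.sum_mul_sq_le_sq_mul_sq _ _ _

lemma opNorm_transpose {α β : Type*} [Fintype α] [Fintype β] [DecidableEq α] [DecidableEq β]
    (M : Matrix α β ℝ) : ‖M.transpose‖ = ‖M‖ := by
  rw [← Matrix.conjTranspose_eq_transpose_of_trivial, Matrix.l2_opNorm_conjTranspose]

lemma opNorm_mul_transpose {α β : Type*} [Fintype α] [Fintype β] [DecidableEq α] [DecidableEq β]
    (M : Matrix α β ℝ) : ‖M * M.transpose‖ = ‖M‖ ^ 2 := by
  have := Matrix.l2_opNorm_conjTranspose_mul_self M.transpose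
  rw [Matrix.conjTranspose_eq_transpose_of_trivial, Matrix.transpose_transpose,
    opNorm_transpose] at this
  rw [this, sq]

/-- The Gram matrix `B` is self-adjoint, so repeated squaring gives `‖B ^ 2 ^ p‖ = ‖B‖ ^ 2 ^ p`, and
the squared Frobenius norm of `B ^ 2 ^ p` is the trace of its square. This is why the moment method
below runs along powers of two. -/
lemma opNorm_pow_le_trace {α β : Type*} [Fintype α] [Fintype β] [DecidableEq α] [DecidableEq β]
    (M : Matrix α β ℝ) (p : ℕ) :
    ‖M‖ ^ (2 * 2 ^ (p + 1)) ≤ ((M * M.transpose) ^ 2 ^ (p + 1)).trace := by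
  set B := M * M.transpose with hB
  have hBt : B.transpose = B := by rw [hB, Matrix.transpose_mul, Matrix.transpose_transpose]
  have hsa : IsSelfAdjoint B := by
    rw [isSelfAdjoint_iff, Matrix.star_eq_conjTranspose,
      Matrix.conjTranspose_eq_transpose_of_trivial, hBt]
  have h1 : ‖B ^ 2 ^ p‖ = ‖B‖ ^ 2 ^ p := congrArg NNReal.toReal (hsa.nnnorm_pow_two_pow p)
  have h2 := opNorm_sq_le_sum_sq (B ^ 2 ^ p)
  have h3 : (B ^ 2 ^ (p + 1)).trace = ∑ a, ∑ b, (B ^ 2 ^ p) a b ^ 2 := by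
    rw [pow_succ 2 p, pow_mul, pow_two]
    nth_rw 2 [← hBt]
    rw [← Matrix.transpose_pow]
    simp only [Matrix.trace, Matrix.diag, Matrix.mul_apply, Matrix.transpose_apply, sq]
  rw [h3]
  refine le_trans (le_of_eq ?_) h2
  rw [h1, hB, opNorm_mul_transpose]
  ring

lemma trace_pow_le_opNorm_pow {α β : Type*} [Fintype α] [Fintype β] [DecidableEq α]
    [DecidableEq β] (M : Matrix α β ℝ) {k : ℕ} (hk : k ≠ 0) :
    ((M * M.transpose) ^ k).trace ≤ Fintype.card α * ‖M‖ ^ (2 * k) := by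
  have hentry : ∀ (B : Matrix α α ℝ) a, B a a ≤ ‖B‖ := by
    intro B a
    have h1 := norm_mulVec_le B (EuclideanSpace.single a 1)
    rw [PiLp.norm_single, norm_one, mul_one] at h1
    have h2 := PiLp.norm_apply_le
      (WithLp.toLp 2 (B.mulVec (EuclideanSpace.single a (1 : ℝ)).ofLp) : EuclideanSpace ℝ α) a
    simp only [PiLp.ofLp_single, Matrix.mulVec_single_one, Matrix.col_apply] at h1 h2
    exact (le_abs_self _).trans (h2.trans h1)
  calc ((M * M.transpose) ^ k).trace ≤ ∑ _a : α, ‖(M * M.transpose) ^ k‖ :=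
        Finset.sum_le_sum fun a _ => hentry _ a
    _ = Fintype.card α * ‖(M * M.transpose) ^ k‖ := by simp
    _ ≤ _ := by
        refine mul_le_mul_of_nonneg_left ?_ (by positivity)
        rw [pow_mul, ← opNorm_mul_transpose]
        exact norm_pow_le' _ (Nat.pos_of_ne_zero hk)

end OperatorNorm

/-! ### Counting recurrent walks with the three point matrix. -/

section RecurrentCount

open scoped Matrix.Norms.L2Operator

/-- The constant in the bound for the number of recurrent walks. -/
noncomputable def walkConst : ℝ := 64 ^ 2 * (4 * Real.exp 4)

lemma walkConst_pos : 0 < walkConst := by unfold walkConst; positivity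

/-- The random matrix with entries from the three point law. -/
noncomputable def threePointMatrix {α β : Type*} (Y : α × β → Fin 3) : Matrix α β ℝ :=
  Matrix.of fun a b => threePoint (Y (a, b))

/-- The norm is bounded by a double average of bilinear forms over unit balls; interchanging this
with the sum over `Y` leaves linear forms in independent variables, to which the Khintchine bound
applies. -/
lemma sum_opNorm_threePointMatrix_pow_le {k : ℕ} (hk : k ≠ 0) :
    ∑ Y : Fin (2 * k) × Fin (2 * k) → Fin 3, ‖threePointMatrix Y‖ ^ (2 * k) ≤
      3 ^ Fintype.card (Fin (2 * k) × Fin (2 * k)) * (2 * (walkConst * k) ^ k) := by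
  set r := 2 * k with hr
  set B := Metric.closedBall (0 : EuclideanSpace ℝ (Fin r)) 1 with hB
  set V := volume.real B with hV
  have hV0 : 0 < V :=
    ENNReal.toReal_pos (Metric.measure_closedBall_pos _ _ one_pos).ne' measure_closedBall_lt_top.ne
  set T : (Fin r × Fin r → Fin 3) → EuclideanSpace ℝ (Fin r) →L[ℝ] EuclideanSpace ℝ (Fin r) :=
    fun Y => Matrix.toEuclideanCLM (𝕜 := ℝ) (threePointMatrix Y) with hT
  set J : (Fin r × Fin r → Fin 3) → ℝ := fun Y => ∫ x in B, ∫ y in B, inner ℝ x (T Y y) ^ (2 * k)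
    with hJ
  set c : ℝ := V * (1 / 64) ^ k with hc
  have hc0 : 0 < c := by positivity
  -- As `r = 2 * k`, the loss is `4 ^ (-3 * k) = 64 ^ (-k)`; it enters squared, which gives the `64
  -- ^ 2` in `walkConst`. The volume cancels against the double integral.
  have hcV : V * (1 / 4) ^ r * (1 / 4) ^ k = c := by
    rw [hc, hr, mul_assoc, pow_mul, ← mul_pow]; norm_num
  have h1 : ∀ Y, ‖threePointMatrix Y‖ ^ (2 * k) ≤ J Y / c ^ 2 := by
    intro Y
    have hJ0 : 0 ≤ J Y := integral_nonneg fun x => integral_nonneg fun y =>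
      (even_two_mul k).pow_nonneg _
    have hJc : 0 ≤ J Y / c ^ 2 := by positivity
    have hroot : ((J Y / c ^ 2) ^ (((2 * k : ℕ) : ℝ)⁻¹)) ^ (2 * k) = J Y / c ^ 2 :=
      Real.rpow_inv_natCast_pow hJc (by omega)
    rw [← hroot]
    refine pow_le_pow_left₀ (norm_nonneg _) ?_ _
    rw [← Matrix.l2_opNorm_toEuclideanCLM]
    refine ContinuousLinearMap.opNorm_le_of_unit_norm (by positivity) fun v hv => ?_
    refine (pow_le_pow_iff_left₀ (norm_nonneg _) (by positivity) (by omega : 2 * k ≠ 0)).1 ?_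
    rw [hroot, le_div_iff₀ (by positivity), mul_comm]
    have := norm_pow_le_integral_unitBall (T Y) k hv.le
    rwa [← hB, ← hV, hcV] at this
  have hint : ∀ Y x, IntegrableOn (fun y => inner ℝ x (T Y y) ^ (2 * k)) B := fun Y x =>
    integrableOn_unitBall (by fun_prop)
  have h2 : ∑ Y, J Y ≤ V ^ 2 * (3 ^ Fintype.card (Fin r × Fin r) *
      (2 * (4 * Real.exp 4 * k) ^ k)) := by
    set L : ℝ := 3 ^ Fintype.card (Fin r × Fin r) * (2 * (4 * Real.exp 4 * k) ^ k) with hL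
    have hpt : ∀ x ∈ B, ∀ y ∈ B, ∑ Y, inner ℝ x (T Y y) ^ (2 * k) ≤ L := by
      intro x hx y hy
      have e1 : ∀ Y, inner ℝ x (T Y y) = ∑ e : Fin r × Fin r, x e.1 * y e.2 * threePoint (Y e) := by
        intro Y
        rw [hT, Matrix.inner_toEuclideanCLM, Fintype.sum_prod_type]
        simp only [dotProduct, Matrix.mulVec, threePointMatrix, Matrix.of_apply, Finset.mul_sum]
        refine Finset.sum_congr rfl fun a _ => Finset.sum_congr rfl fun b _ => by ring
      simp_rw [e1]
      refine (sum_pow_sum_threePoint_le (fun e : Fin r × Fin r => x e.1 * y e.2) hk).trans ?_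
      have hx1 : ‖x‖ ^ 2 ≤ 1 := pow_le_one₀ (norm_nonneg _) (by simpa [hB] using hx)
      have hy1 : ‖y‖ ^ 2 ≤ 1 := pow_le_one₀ (norm_nonneg _) (by simpa [hB] using hy)
      have hs : ∑ e : Fin r × Fin r, (x e.1 * y e.2) ^ 2 ≤ 1 := by
        rw [Fintype.sum_prod_type]
        simp_rw [mul_pow, ← Finset.mul_sum]
        rw [← Finset.sum_mul, ← EuclideanSpace.real_norm_sq_eq, ← EuclideanSpace.real_norm_sq_eq]
        exact mul_le_one₀ hx1 (by positivity) hy1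
      rw [hL]
      refine mul_le_mul_of_nonneg_left ?_ (by positivity)
      refine mul_le_mul_of_nonneg_left ?_ (by positivity)
      refine pow_le_pow_left₀ (by positivity) ?_ _
      exact mul_le_of_le_one_right (by positivity) hs
    have hcont : ∀ Y, IntegrableOn
        (fun x => ∫ y in B, inner ℝ x (T Y y) ^ (2 * k)) B := fun Y =>
      integrableOn_unitBall (continuous_integral_unitBall_inner_pow (T Y) k)
    have hconst : ∀ b : ℝ, IntegrableOn (fun _ : EuclideanSpace ℝ (Fin r) => b) B := fun b =>
      integrableOn_const (measure_closedBall_lt_top.ne)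
    calc ∑ Y, J Y = ∫ x in B, ∑ Y, ∫ y in B, inner ℝ x (T Y y) ^ (2 * k) :=
          (integral_finsetSum _ fun Y _ => hcont Y).symm
      _ = ∫ x in B, ∫ y in B, ∑ Y, inner ℝ x (T Y y) ^ (2 * k) := by
          congr 1
          ext x
          exact (integral_finsetSum _ fun Y _ => hint Y x).symm
      _ ≤ ∫ x in B, V * L := by
          refine setIntegral_mono_on ?_ (hconst _) measurableSet_closedBall fun x hx => ?_
          · have : (fun x => ∫ y in B, ∑ Y, inner ℝ x (T Y y) ^ (2 * k)) =
                fun x => ∑ Y, ∫ y in B, inner ℝ x (T Y y) ^ (2 * k) := by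
              ext x
              exact integral_finsetSum _ fun Y _ => hint Y x
            rw [this]
            exact integrable_finsetSum _ fun Y _ => hcont Y
          · calc ∫ y in B, ∑ Y, inner ℝ x (T Y y) ^ (2 * k) ≤ ∫ y in B, L :=
                  setIntegral_mono_on (integrable_finsetSum _ fun Y _ => hint Y x) (hconst _)
                    measurableSet_closedBall fun y hy => hpt x hx y hy
              _ = V * L := by rw [setIntegral_const, smul_eq_mul]
      _ = _ := by rw [setIntegral_const, smul_eq_mul]; ring
  calc _ ≤ ∑ Y, J Y / c ^ 2 := Finset.sum_le_sum fun Y _ => h1 Y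
    _ = (∑ Y, J Y) / c ^ 2 := (Finset.sum_div _ _ _).symm
    _ ≤ V ^ 2 * (3 ^ Fintype.card (Fin r × Fin r) * (2 * (4 * Real.exp 4 * k) ^ k)) / c ^ 2 := by
        gcongr
    _ = _ := by
        rw [hc, walkConst, mul_pow V, ← pow_mul (1 / 64 : ℝ), mul_comm k 2, pow_mul (1 / 64 : ℝ),
          mul_div_mul_left _ _ (by positivity), one_div, inv_pow, inv_pow, div_inv_eq_mul]
        simp only [mul_pow]
        ring

-- The sum over `Y` of the trace is computed twice. Expanded in walks, every recurrent walk
-- contributes at least `D` and every other one a nonnegative amount; from above, the trace is at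
-- most the dimension `2 * k` times a power of the norm.
open Classical in
lemma card_recurrent_le {k : ℕ} (hk : k ≠ 0) :
    ∑ i : Fin (k + 1) → Fin (2 * k), ∑ j : Fin k → Fin (2 * k),
        (if IsRecurrent (Setoid.ker i) (Setoid.ker j) then (1 : ℝ) else 0) ≤
      4 * k * (walkConst * k) ^ k := by
  set D : ℝ := 3 ^ Fintype.card (Fin (2 * k) × Fin (2 * k)) with hD
  have hD0 : 0 < D := by positivity
  have h1 : D * ∑ i : Fin (k + 1) → Fin (2 * k), ∑ j : Fin k → Fin (2 * k),
        (if IsRecurrent (Setoid.ker i) (Setoid.ker j) then (1 : ℝ) else 0) ≤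
      ∑ Y : Fin (2 * k) × Fin (2 * k) → Fin 3,
        ((threePointMatrix Y * (threePointMatrix Y).transpose) ^ k).trace := by
    simp_rw [trace_mul_transpose_pow]
    conv_rhs => rw [Finset.sum_comm]
    rw [Finset.mul_sum]
    refine Finset.sum_le_sum fun i _ => ?_
    conv_rhs => rw [Finset.sum_comm]
    rw [Finset.mul_sum]
    refine Finset.sum_le_sum fun j _ => ?_
    by_cases hc : i 0 = i (Fin.last k)
    · simp only [if_pos hc]
      split_ifs with h
      · rw [mul_one]
        exact le_sum_prod_threePoint ((isRecurrent_ker_iff i j).1 h).2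
      · rw [mul_zero]
        exact sum_prod_threePoint_nonneg (walkEdge i j)
    · simp only [if_neg hc]
      rw [if_neg fun h => hc ((isRecurrent_ker_iff i j).1 h).1]
      simp
  have h2 : ∑ Y : Fin (2 * k) × Fin (2 * k) → Fin 3,
        ((threePointMatrix Y * (threePointMatrix Y).transpose) ^ k).trace ≤
      D * (4 * k * (walkConst * k) ^ k) := by
    calc _ ≤ ∑ Y : Fin (2 * k) × Fin (2 * k) → Fin 3,
          (Fintype.card (Fin (2 * k)) : ℝ) * ‖threePointMatrix Y‖ ^ (2 * k) :=
          Finset.sum_le_sum fun Y _ => trace_pow_le_opNorm_pow _ hk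
      _ ≤ (Fintype.card (Fin (2 * k)) : ℝ) * (D * (2 * (walkConst * k) ^ k)) := by
          rw [← Finset.mul_sum]
          exact mul_le_mul_of_nonneg_left (sum_opNorm_threePointMatrix_pow_le hk) (by positivity)
      _ = _ := by rw [Fintype.card_fin]; push_cast; ring
  exact le_of_mul_le_mul_left (h1.trans h2) hD0

end RecurrentCount

/-! ### Moment method for independent, centred, bounded entries. -/

section TraceMoments

variable {Ω : Type*} [MeasurableSpace Ω] {P : Measure Ω} [IsProbabilityMeasure P]

/-- Moments of a centred random variable with values in `[-K, K]` and variance at most one. -/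
lemma abs_integral_pow_le {X : Ω → ℝ} (hX : AEMeasurable X P) {K : ℝ} (hK : 1 ≤ K)
    (hb : ∀ ω, |X ω| ≤ K) (h2 : ∫ ω, X ω ^ 2 ∂P ≤ 1) {m : ℕ} (hm : m ≠ 1) :
    |∫ ω, X ω ^ m ∂P| ≤ K ^ m * (if m = 0 then 1 else (K ^ 2)⁻¹) := by
  have hK0 : 0 < K := by linarith
  rcases m with _ | _ | m
  · simp
  · exact absurd rfl hm
  have hint : ∀ n : ℕ, Integrable (fun ω => X ω ^ n) P := fun n =>
    Integrable.of_bound (hX.pow_const n).aestronglyMeasurable (K ^ n)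
      (Eventually.of_forall fun ω => by
        rw [norm_pow, Real.norm_eq_abs]; exact pow_le_pow_left₀ (abs_nonneg _) (hb ω) n)
  calc |∫ ω, X ω ^ (m + 1 + 1) ∂P| ≤ ∫ ω, |X ω ^ (m + 1 + 1)| ∂P := abs_integral_le_integral_abs
    _ ≤ ∫ ω, K ^ m * X ω ^ 2 ∂P := by
        refine integral_mono (hint _).abs ((hint 2).const_mul _) fun ω => ?_
        simp only [abs_pow]
        rw [add_assoc, pow_add, sq_abs]
        exact mul_le_mul_of_nonneg_right (pow_le_pow_left₀ (abs_nonneg _) (hb ω) m) (sq_nonneg _)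
    _ = K ^ m * ∫ ω, X ω ^ 2 ∂P := integral_const_mul _ _
    _ ≤ K ^ m := mul_le_of_le_one_right (by positivity) h2
    _ = _ := by
        rw [if_neg (by omega)]
        field_simp
        ring

omit [IsProbabilityMeasure P] in
lemma integral_prod_eq_prod_integral_pow {τ β : Type*} [Fintype τ] [Fintype β] [DecidableEq β]
    {A : β → Ω → ℝ} (hA : ∀ e, AEMeasurable (A e) P) (hind : iIndepFun A P) (E : τ → β) :
    ∫ ω, ∏ t, A (E t) ω ∂P =
      ∏ e, ∫ ω, A e ω ^ (Finset.univ.filter fun t => E t = e).card ∂P := by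
  rw [← hind.integral_fun_prod_comp hA
    (f := fun e x => x ^ (Finset.univ.filter fun t => E t = e).card)
    (fun e => (measurable_id.pow_const _).aestronglyMeasurable)]
  congr 1
  ext ω
  rw [← Finset.prod_fiberwise Finset.univ E]
  refine Finset.prod_congr rfl fun e _ => ?_
  rw [← Finset.prod_const]
  refine Finset.prod_congr rfl fun t ht => ?_
  rw [(Finset.mem_filter.1 ht).2]

omit [IsProbabilityMeasure P] in
lemma integral_prod_eq_zero {τ β : Type*} [Fintype τ] [Fintype β] [DecidableEq β]
    {A : β → Ω → ℝ} (hA : ∀ e, AEMeasurable (A e) P) (hind : iIndepFun A P)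
    (h0 : ∀ e, ∫ ω, A e ω ∂P = 0) {E : τ → β} (hE : ¬ ∀ t, ∃ t', t' ≠ t ∧ E t' = E t) :
    ∫ ω, ∏ t, A (E t) ω ∂P = 0 := by
  push Not at hE
  obtain ⟨t, ht⟩ := hE
  rw [integral_prod_eq_prod_integral_pow hA hind]
  refine Finset.prod_eq_zero (Finset.mem_univ (E t)) ?_
  have : (Finset.univ.filter fun t' => E t' = E t) = {t} := by
    ext t'
    simp only [Finset.mem_filter, Finset.mem_univ, true_and, Finset.mem_singleton]
    constructor
    · intro h
      by_contra h'
      exact ht t' h' h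
    · rintro rfl; rfl
  rw [this]
  simpa using h0 (E t)

/-- By independence the integral factors over the distinct edges. Each of them occurs at least
twice, so its second moment replaces two factors `K` by one and saves `K ^ 2`. -/
lemma integral_prod_le {τ β : Type*} [Fintype τ] [Fintype β] [DecidableEq β]
    {A : β → Ω → ℝ} (hA : ∀ e, AEMeasurable (A e) P) (hind : iIndepFun A P)
    {K : ℝ} (hK : 1 ≤ K) (hb : ∀ e ω, |A e ω| ≤ K) (h2 : ∀ e, ∫ ω, A e ω ^ 2 ∂P ≤ 1)
    {E : τ → β} (hE : ∀ t, ∃ t', t' ≠ t ∧ E t' = E t) :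
    ∫ ω, ∏ t, A (E t) ω ∂P ≤
      K ^ Fintype.card τ * ((K ^ 2)⁻¹) ^ (Finset.univ.image E).card := by
  rw [integral_prod_eq_prod_integral_pow hA hind]
  refine (le_abs_self _).trans ?_
  rw [Finset.abs_prod]
  refine (Finset.prod_le_prod (fun e _ => abs_nonneg _) fun e _ =>
    abs_integral_pow_le (hA e) hK (hb e) (h2 e) (card_fiber_ne_one hE e)).trans (le_of_eq ?_)
  rw [Finset.prod_mul_distrib, Finset.prod_pow_eq_pow_sum,
    ← Finset.card_eq_sum_card_fiberwise (fun t _ => Finset.mem_univ (E t)), Finset.card_univ]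
  congr 1
  rw [← Finset.prod_const, ← Finset.prod_subset (Finset.subset_univ (Finset.univ.image E))]
  · refine Finset.prod_congr rfl fun e he => ?_
    obtain ⟨t, -, rfl⟩ := Finset.mem_image.1 he
    rw [if_neg]
    exact (Finset.card_pos.2 ⟨t, by simp⟩).ne'
  · intro e _ he
    rw [if_pos]
    rw [Finset.card_eq_zero, Finset.filter_eq_empty_iff]
    rintro t - rfl
    exact he (Finset.mem_image_of_mem _ (Finset.mem_univ t))

lemma integrable_prod_of_bounded {τ β : Type*} [Fintype τ]
    {A : β → Ω → ℝ} (hA : ∀ e, AEMeasurable (A e) P) {K : ℝ} (hb : ∀ e ω, |A e ω| ≤ K)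
    (E : τ → β) : Integrable (fun ω => ∏ t, A (E t) ω) P := by
  refine Integrable.of_bound
    (Finset.aemeasurable_fun_prod _ fun t _ => hA (E t)).aestronglyMeasurable
    (∏ _t : τ, K) (Eventually.of_forall fun ω => ?_)
  rw [Real.norm_eq_abs, Finset.abs_prod]
  exact Finset.prod_le_prod (fun t _ => abs_nonneg _) fun t _ => hb _ _

lemma integrable_trace_pow {α β : Type*} [Fintype α] [Fintype β] [DecidableEq α]
    {A : α × β → Ω → ℝ} (hA : ∀ e, AEMeasurable (A e) P) {K : ℝ} (hb : ∀ e ω, |A e ω| ≤ K)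
    (k : ℕ) : Integrable (fun ω => (((Matrix.of fun a b => A (a, b) ω) *
      (Matrix.of fun a b => A (a, b) ω).transpose) ^ k).trace) P := by
  simp_rw [trace_mul_transpose_pow]
  refine integrable_finsetSum _ fun i _ => integrable_finsetSum _ fun j _ => ?_
  split_ifs
  · exact integrable_prod_of_bounded hA hb (walkEdge i j)
  · exact integrable_zero _ _ _

open Classical in
/-- Moment bound for a random matrix with independent, centred, bounded entries. -/
lemma integral_trace_pow_le {α β : Type*} [Fintype α] [Fintype β] [DecidableEq α]
    [DecidableEq β] {A : α × β → Ω → ℝ} (hA : ∀ e, AEMeasurable (A e) P) (hind : iIndepFun A P)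
    {K : ℝ} (hK : 1 ≤ K) (hb : ∀ e ω, |A e ω| ≤ K) (h0 : ∀ e, ∫ ω, A e ω ∂P = 0)
    (h2 : ∀ e, ∫ ω, A e ω ^ 2 ∂P ≤ 1) {k : ℕ} (hk : k ≠ 0)
    (hα : (Fintype.card α : ℝ) ≤ k * K ^ 2) (hβ : (Fintype.card β : ℝ) ≤ k * K ^ 2) :
    ∫ ω, (((Matrix.of fun a b => A (a, b) ω) *
      (Matrix.of fun a b => A (a, b) ω).transpose) ^ k).trace ∂P ≤
      4 * (k * K ^ 2) * (walkConst * (k * K ^ 2)) ^ k := by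
  have hK0 : 0 < K := by linarith
  set q : ℝ := (K ^ 2)⁻¹ with hq
  have hq0 : 0 ≤ q := by positivity
  have hq1 : q ≤ 1 := inv_le_one_of_one_le₀ (one_le_pow₀ hK)
  have hqK : q * K ^ 2 = 1 := inv_mul_cancel₀ (by positivity)
  have hterm : ∀ (i : Fin (k + 1) → α) (j : Fin k → β),
      ∫ ω, (if i 0 = i (Fin.last k) then
        ∏ t, (Matrix.of fun a b => A (a, b) ω) (walkEdge i j t).1 (walkEdge i j t).2
        else 0) ∂P ≤ K ^ (2 * k + 2) * (q ^ ((Finset.univ.image i).card +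
          (Finset.univ.image j).card) *
        (if IsRecurrent (Setoid.ker i) (Setoid.ker j) then 1 else 0)) := by
    intro i j
    by_cases hc : i 0 = i (Fin.last k)
    · simp only [if_pos hc, Matrix.of_apply]
      by_cases hr : ∀ t, ∃ t', t' ≠ t ∧ walkEdge i j t' = walkEdge i j t
      · rw [if_pos ((isRecurrent_ker_iff i j).2 ⟨hc, hr⟩), mul_one]
        refine (integral_prod_le hA hind hK hb h2 hr).trans ?_
        have hcard : Fintype.card (Fin k ⊕ Fin k) = 2 * k := by simp; ring
        rw [hcard, ← hq, pow_add, mul_assoc]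
        refine mul_le_mul_of_nonneg_left ?_ (by positivity)
        -- There are at most one more vertices than edges and `q ≤ 1`, so at the cost of one factor
        -- `K ^ 2` the weight `q` per edge becomes a weight `q` per vertex, the form needed for the
        -- comparison of walks.
        have h := card_image_add_card_image_le i j
        have h' : q ^ ((Finset.univ.image (walkEdge i j)).card + 1) ≤
            q ^ ((Finset.univ.image i).card + (Finset.univ.image j).card) :=
          pow_le_pow_of_le_one hq0 hq1 h
        rw [pow_succ] at h'
        calc q ^ (Finset.univ.image (walkEdge i j)).card
            = K ^ 2 * (q ^ (Finset.univ.image (walkEdge i j)).card * q) := by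
              rw [mul_comm (K ^ 2), mul_assoc, hqK, mul_one]
          _ ≤ _ := mul_le_mul_of_nonneg_left h' (by positivity)
      · rw [if_neg fun h => hr ((isRecurrent_ker_iff i j).1 h).2, mul_zero, mul_zero]
        exact (integral_prod_eq_zero hA hind h0 hr).le
    · simp only [if_neg hc, integral_zero]
      positivity
  have hint : ∀ (i : Fin (k + 1) → α) (j : Fin k → β),
      Integrable (fun ω => if i 0 = i (Fin.last k) then
        ∏ t, (Matrix.of fun a b => A (a, b) ω) (walkEdge i j t).1 (walkEdge i j t).2
        else 0) P := by
    intro i j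
    split_ifs
    · exact integrable_prod_of_bounded hA hb (walkEdge i j)
    · exact integrable_zero _ _ _
  have hcard : ∀ x : ℝ, x ≤ k * K ^ 2 → q * x ≤ k := by
    intro x hx
    calc q * x ≤ q * (k * K ^ 2) := mul_le_mul_of_nonneg_left hx hq0
      _ = k * (q * K ^ 2) := by ring
      _ = k := by rw [hqK, mul_one]
  simp_rw [trace_mul_transpose_pow]
  rw [integral_finsetSum _ fun i _ => integrable_finsetSum _ fun j _ => hint i j]
  calc ∑ i : Fin (k + 1) → α, ∫ ω, ∑ j : Fin k → β, (if i 0 = i (Fin.last k) then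
        ∏ t, (Matrix.of fun a b => A (a, b) ω) (walkEdge i j t).1 (walkEdge i j t).2
        else 0) ∂P
      = ∑ i : Fin (k + 1) → α, ∑ j : Fin k → β, ∫ ω, (if i 0 = i (Fin.last k) then
        ∏ t, (Matrix.of fun a b => A (a, b) ω) (walkEdge i j t).1 (walkEdge i j t).2
        else 0) ∂P :=
        Finset.sum_congr rfl fun i _ => integral_finsetSum _ fun j _ => hint i j
    _ ≤ ∑ i : Fin (k + 1) → α, ∑ j : Fin k → β, K ^ (2 * k + 2) *
        (q ^ ((Finset.univ.image i).card + (Finset.univ.image j).card) *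
        (if IsRecurrent (Setoid.ker i) (Setoid.ker j) then 1 else 0)) :=
        Finset.sum_le_sum fun i _ => Finset.sum_le_sum fun j _ => hterm i j
    _ ≤ K ^ (2 * k + 2) * (4 * k * (walkConst * k) ^ k) := by
        simp_rw [← Finset.mul_sum]
        refine mul_le_mul_of_nonneg_left ?_ (by positivity)
        exact (sum_recurrent_weighted_le hq0 (hcard _ hα) (hcard _ hβ)).trans (card_recurrent_le hk)
    _ = _ := by
        rw [pow_add, pow_mul]
        simp only [mul_pow]
        ring

open scoped Matrix.Norms.L2Operator in
/-- Tail bound for the operator norm of a random matrix with independent, centred, bounded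
entries. -/
lemma measure_opNorm_sq_gt_le {α β : Type*} [Fintype α] [Fintype β] [DecidableEq α]
    [DecidableEq β] {A : α × β → Ω → ℝ} (hA : ∀ e, AEMeasurable (A e) P) (hind : iIndepFun A P)
    {K : ℝ} (hK : 1 ≤ K) (hb : ∀ e ω, |A e ω| ≤ K) (h0 : ∀ e, ∫ ω, A e ω ∂P = 0)
    (h2 : ∀ e, ∫ ω, A e ω ^ 2 ∂P ≤ 1) (p : ℕ)
    (hα : (Fintype.card α : ℝ) ≤ 2 ^ (p + 1) * K ^ 2)
    (hβ : (Fintype.card β : ℝ) ≤ 2 ^ (p + 1) * K ^ 2) :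
    P {ω | 4 * walkConst * (2 ^ (p + 1) * K ^ 2) <
        ‖(Matrix.of fun a b => A (a, b) ω : Matrix α β ℝ)‖ ^ 2} ≤
      ENNReal.ofReal (4 * (2 ^ (p + 1) * K ^ 2) / 4 ^ 2 ^ (p + 1)) := by
  set k : ℕ := 2 ^ (p + 1) with hk
  have hkr : (2 ^ (p + 1) : ℝ) = (k : ℝ) := by rw [hk]; push_cast; rfl
  have hk0 : k ≠ 0 := by positivity
  have hk0' : (0 : ℝ) < k := by positivity
  have hK0 : 0 < K := by linarith
  rw [hkr] at hα hβ ⊢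
  set T : Ω → ℝ := fun ω => (((Matrix.of fun a b => A (a, b) ω) *
      (Matrix.of fun a b => A (a, b) ω : Matrix α β ℝ).transpose) ^ k).trace with hT
  have hTle : ∀ ω, (‖(Matrix.of fun a b => A (a, b) ω : Matrix α β ℝ)‖ ^ 2) ^ k ≤ T ω := by
    intro ω
    rw [← pow_mul]
    exact opNorm_pow_le_trace _ p
  have hT0 : ∀ ω, 0 ≤ T ω := fun ω => le_trans (by positivity) (hTle ω)
  -- The factor `4` over the base of the moment bound becomes the decay `4 ^ (-k)` in Markov's
  -- inequality for the `k`-th power.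
  set c : ℝ := 4 * walkConst * (k * K ^ 2) with hc
  have hc0 : 0 < c := by have := walkConst_pos; positivity
  have hTint : Integrable T P := integrable_trace_pow hA hb k
  have hmarkov := mul_meas_ge_le_integral_of_nonneg (Eventually.of_forall hT0) hTint (c ^ k)
  have hbound := integral_trace_pow_le hA hind hK hb h0 h2 hk0 hα hβ
  have hreal : P.real {ω | c ^ k ≤ T ω} ≤ 4 * (k * K ^ 2) / 4 ^ k := by
    rw [le_div_iff₀ (by positivity)]
    have h1 : c ^ k * P.real {ω | c ^ k ≤ T ω} ≤
        4 * (k * K ^ 2) * (walkConst * (k * K ^ 2)) ^ k := hmarkov.trans hbound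
    have h3 : 0 < (walkConst * (k * K ^ 2)) ^ k := by have := walkConst_pos; positivity
    generalize P.real {ω | c ^ k ≤ T ω} = Q at h1 ⊢
    rw [hc, mul_assoc 4, mul_pow 4] at h1
    refine le_of_mul_le_mul_right ?_ h3
    linarith
  have hsub : {ω | c < ‖(Matrix.of fun a b => A (a, b) ω : Matrix α β ℝ)‖ ^ 2} ⊆
      {ω | c ^ k ≤ T ω} := by
    intro ω hω
    exact (pow_le_pow_left₀ hc0.le (le_of_lt hω) k).trans (hTle ω)
  refine (measure_mono hsub).trans ?_
  rw [← ofReal_measureReal]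
  exact ENNReal.ofReal_le_ofReal hreal

end TraceMoments

/-! ### Truncation, and the norm of a matrix with i.i.d. entries. -/

section IIDMatrix

/-- For `k = 2 ^ (p + 1)` between `log₂ N` and `2 log₂ N`, up to rounding, everything follows from
`k ≤ N ^ a` with small `a`. In order, the conditions make the truncation level at least one, control
the mean of the truncated law, let the decay `4 ^ (-k)` beat the dimension, bound the probability
that some entry is truncated, and bound the remaining tail. -/
lemma eventually_exists_power_of_two {ε δ M : ℝ} (hε : 0 < ε) (hδ : 0 < δ) (hM : 0 ≤ M) :
    ∀ᶠ N : ℕ in atTop, ∃ p : ℕ, 4 * 2 ^ (p + 1) ≤ (N : ℝ) ∧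
      ((2 : ℝ) ^ (p + 1)) ^ 3 ≤ (N : ℝ) ^ 2 ∧ (N : ℝ) ≤ 2 ^ 2 ^ (p + 1) ∧
      M * (N : ℝ) ^ 2 * (4 * 2 ^ (p + 1) / N) ^ (2 + ε / 2) ≤ δ ∧ 4 / (N : ℝ) ≤ δ := by
  -- This solves `a * (2 + ε / 2) = ε / 4`, so that `N ^ 2 * (N ^ (a - 1)) ^ (2 + ε / 2) = N ^ (-(ε
  -- / 4))`.
  set a : ℝ := ε / (8 + 2 * ε) with ha
  have ha0 : 0 < a := by positivity
  have ha2 : a ≤ 1 / 2 := by rw [ha, div_le_div_iff₀ (by positivity) (by norm_num)]; linarith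
  have haε : a * (2 + ε / 2) = ε / 4 := by rw [ha]; field_simp; ring
  have hcast : Tendsto (fun N : ℕ => (N : ℝ)) atTop atTop := tendsto_natCast_atTop_atTop
  have h1 : ∀ᶠ N : ℕ in atTop, 4 * Real.log N ≤ (N : ℝ) ^ a := by
    have := (isLittleO_log_rpow_atTop ha0).bound (by norm_num : (0 : ℝ) < 1 / 4)
    filter_upwards [hcast.eventually this, eventually_ge_atTop 1] with N hN hN1
    have hN1' : (1 : ℝ) ≤ N := by exact_mod_cast hN1
    rw [Real.norm_of_nonneg (Real.log_nonneg hN1'), Real.norm_of_nonneg (by positivity)] at hN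
    linarith
  have h2 : ∀ᶠ N : ℕ in atTop, M * 4 ^ (2 + ε / 2) * (N : ℝ) ^ (-(ε / 4)) ≤ δ := by
    have : Tendsto (fun N : ℕ => M * 4 ^ (2 + ε / 2) * (N : ℝ) ^ (-(ε / 4))) atTop
        (nhds (M * 4 ^ (2 + ε / 2) * 0)) :=
      ((tendsto_rpow_neg_atTop (by positivity)).comp hcast).const_mul _
    rw [mul_zero] at this
    exact this.eventually_le_const hδ
  have h3 : ∀ᶠ N : ℕ in atTop, 4 / (N : ℝ) ≤ δ :=
    (tendsto_const_nhds.div_atTop hcast).eventually_le_const hδ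
  filter_upwards [h1, h2, h3, eventually_ge_atTop 16] with N h1 h2 h3 hN
  have hN16 : (16 : ℝ) ≤ N := by exact_mod_cast hN
  have hN0 : (0 : ℝ) < N := by linarith
  set L := Nat.log 2 N with hL
  have hL1 : L ≠ 0 := (Nat.log_pos one_lt_two (by omega)).ne'
  refine ⟨Nat.log 2 L, ?_⟩
  set k := 2 ^ (Nat.log 2 L + 1) with hk
  have hkL : L < k := Nat.lt_pow_succ_log_self one_lt_two L
  have hkL2 : k ≤ 2 * L := by
    rw [hk, pow_succ, mul_comm]
    exact Nat.mul_le_mul_left 2 (Nat.pow_log_le_self 2 hL1)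
  have hNk : N ≤ 2 ^ k :=
    (Nat.lt_pow_succ_log_self one_lt_two N).le.trans (Nat.pow_le_pow_right two_pos hkL)
  have hLlog : (L : ℝ) ≤ 2 * Real.log N := by
    have e1 : (2 : ℝ) ^ L ≤ N := by exact_mod_cast Nat.pow_log_le_self 2 (by omega)
    have e2 := Real.log_le_log (by positivity) e1
    rw [Real.log_pow] at e2
    have e3 := Real.log_two_gt_d9
    have e4 : (0 : ℝ) ≤ L := by positivity
    nlinarith
  have hkr : ((2 : ℝ) ^ (Nat.log 2 L + 1)) = (k : ℝ) := by rw [hk]; push_cast; rfl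
  rw [hkr]
  have hka : (k : ℝ) ≤ (N : ℝ) ^ a := by
    have : (k : ℝ) ≤ 2 * L := by exact_mod_cast hkL2
    linarith
  have hksq : (k : ℝ) ≤ √N := by
    rw [Real.sqrt_eq_rpow]
    exact hka.trans (Real.rpow_le_rpow_of_exponent_le (by linarith) ha2)
  have hk2 : (k : ℝ) ^ 2 ≤ N := (Real.le_sqrt (by positivity) hN0.le).1 hksq
  have hk1 : (1 : ℝ) ≤ k := by exact_mod_cast (by omega : 1 ≤ k)
  refine ⟨?_, ?_, by exact_mod_cast hNk, ?_, h3⟩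
  · have : (4 : ℝ) ≤ √N := by
      rw [show (4 : ℝ) = √16 by rw [show (16 : ℝ) = 4 ^ 2 by norm_num]; simp]
      exact Real.sqrt_le_sqrt hN16
    have hs := Real.mul_self_sqrt hN0.le
    nlinarith
  · have : (k : ℝ) ^ 3 ≤ k ^ 4 := pow_le_pow_right₀ hk1 (by norm_num)
    have h5 : ((k : ℝ) ^ 2) ^ 2 ≤ (N : ℝ) ^ 2 := pow_le_pow_left₀ (by positivity) hk2 2
    calc (k : ℝ) ^ 3 ≤ k ^ 4 := this
      _ = ((k : ℝ) ^ 2) ^ 2 := by ring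
      _ ≤ _ := h5
  · refine le_trans ?_ h2
    have e1 : (4 * k / N : ℝ) ≤ 4 * (N : ℝ) ^ (a - 1) := by
      rw [Real.rpow_sub_one hN0.ne', mul_div_assoc]
      gcongr
    calc M * (N : ℝ) ^ 2 * (4 * k / N) ^ (2 + ε / 2)
        ≤ M * (N : ℝ) ^ 2 * (4 * (N : ℝ) ^ (a - 1)) ^ (2 + ε / 2) := by gcongr
      _ = M * 4 ^ (2 + ε / 2) * ((N : ℝ) ^ (2 : ℝ) * (N : ℝ) ^ ((a - 1) * (2 + ε / 2))) := by
          rw [Real.mul_rpow (by norm_num) (by positivity), ← Real.rpow_mul hN0.le,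
            Real.rpow_two]
          ring
      _ = _ := by
          rw [← Real.rpow_add hN0]
          congr 2
          linarith

variable {ν : Measure ℝ} [IsProbabilityMeasure ν] {s ε : ℝ}

omit [IsProbabilityMeasure ν] in
lemma abs_pow_le_one_add_rpow (hε : 0 < ε) (x : ℝ) {m : ℕ} (hm : m ≤ 4) :
    |x| ^ m ≤ 1 + |x| ^ (4 + ε) := by
  have h0 : 0 ≤ |x| ^ (4 + ε) := by positivity
  rcases le_total |x| 1 with h | h
  · have := pow_le_one₀ (n := m) (abs_nonneg x) h
    linarith
  · have : |x| ^ m ≤ |x| ^ (4 + ε) := by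
      rw [← Real.rpow_natCast]
      refine Real.rpow_le_rpow_of_exponent_le h ?_
      have : (m : ℝ) ≤ 4 := by exact_mod_cast hm
      linarith
    linarith

lemma integrable_pow_of_moment (hε : 0 < ε)
    (hmoment : Integrable (fun x : ℝ => |x| ^ (4 + ε)) ν) {m : ℕ} (hm : m ≤ 4) :
    Integrable (fun x : ℝ => x ^ m) ν := by
  refine Integrable.mono' ((integrable_const 1).add hmoment)
    (measurable_id.pow_const m).aestronglyMeasurable (Eventually.of_forall fun x => ?_)
  rw [norm_pow, Real.norm_eq_abs]
  exact abs_pow_le_one_add_rpow hε x hm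

lemma integral_sq_eq (hε : 0 < ε) (hmoment : Integrable (fun x : ℝ => |x| ^ (4 + ε)) ν)
    (hmean : ∫ x, x ∂ν = 0) (hvar : variance id ν = s ^ 2) : ∫ x, x ^ 2 ∂ν = s ^ 2 := by
  have hL2 : MemLp (id : ℝ → ℝ) 2 ν :=
    (memLp_two_iff_integrable_sq measurable_id.aestronglyMeasurable).2
      (integrable_pow_of_moment hε hmoment (by norm_num))
  rw [variance_eq_sub hL2] at hvar
  simpa [hmean] using hvar

lemma measure_abs_gt_le {q : ℝ} (hq : 0 < q) (hmoment : Integrable (fun x : ℝ => |x| ^ q) ν)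
    {t : ℝ} (ht : 0 < t) :
    ν {x | t < |x|} ≤ ENNReal.ofReal ((∫ x, |x| ^ q ∂ν) / t ^ q) := by
  have hmarkov := mul_meas_ge_le_integral_of_nonneg
    (Eventually.of_forall fun x : ℝ => (by positivity : 0 ≤ |x| ^ q)) hmoment (t ^ q)
  have hsub : {x : ℝ | t < |x|} ⊆ {x | t ^ q ≤ |x| ^ q} := fun x hx =>
    Real.rpow_le_rpow ht.le (le_of_lt hx) hq.le
  refine (measure_mono hsub).trans ?_
  rw [← ofReal_measureReal]
  refine ENNReal.ofReal_le_ofReal ?_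
  rw [le_div_iff₀ (by positivity), mul_comm]
  exact hmarkov

/-- Truncation at level `t`. -/
noncomputable def truncate (t : ℝ) (x : ℝ) : ℝ := if |x| ≤ t then x else 0

lemma measurable_truncate (t : ℝ) : Measurable (truncate t) :=
  Measurable.ite (measurableSet_le measurable_norm measurable_const) measurable_id measurable_const

lemma abs_truncate_le {t : ℝ} (ht : 0 ≤ t) (x : ℝ) : |truncate t x| ≤ t := by
  unfold truncate
  split_ifs with h
  · exact h
  · simpa using ht

lemma truncate_sq_le (t x : ℝ) : truncate t x ^ 2 ≤ x ^ 2 := by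
  unfold truncate
  split_ifs
  · exact le_rfl
  · simp [sq_nonneg]

lemma abs_sub_truncate_le {t : ℝ} (ht : 1 ≤ t) (hε : 0 < ε) (x : ℝ) :
    |x - truncate t x| ≤ |x| ^ (4 + ε) / t ^ 3 := by
  unfold truncate
  split_ifs with h
  · simp only [sub_self, abs_zero]; positivity
  · push Not at h
    rw [sub_zero, le_div_iff₀ (by positivity)]
    calc |x| * t ^ 3 ≤ |x| * |x| ^ 3 := by gcongr
      _ = |x| ^ (4 : ℝ) := by rw [← pow_succ']; norm_cast
      _ ≤ _ := Real.rpow_le_rpow_of_exponent_le (by linarith) (by linarith)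

lemma integrable_of_abs_le {f : ℝ → ℝ} (hf : Measurable f) {c : ℝ} (h : ∀ x, |f x| ≤ c) :
    Integrable f ν :=
  Integrable.of_bound hf.aestronglyMeasurable c (Eventually.of_forall h)

/-- The full law is centred, so the mean after truncation is minus that of the discarded tail, which
the moment bound makes of order `t ^ (-3)`. -/
lemma abs_integral_truncate_le (hε : 0 < ε)
    (hmoment : Integrable (fun x : ℝ => |x| ^ (4 + ε)) ν) (hmean : ∫ x, x ∂ν = 0)
    {t : ℝ} (ht : 1 ≤ t) :
    |∫ x, truncate t x ∂ν| ≤ (∫ x, |x| ^ (4 + ε) ∂ν) / t ^ 3 := by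
  have hint : Integrable (fun x : ℝ => x) ν := by
    simpa using integrable_pow_of_moment (m := 1) hε hmoment (by norm_num)
  have htr : Integrable (truncate t) ν :=
    integrable_of_abs_le (measurable_truncate t) (abs_truncate_le (by linarith))
  have h1 : |∫ x, truncate t x ∂ν| = |∫ x, (x - truncate t x) ∂ν| := by
    rw [integral_sub hint htr, hmean, zero_sub, abs_neg]
  rw [h1, ← integral_div]
  refine abs_integral_le_integral_abs.trans ?_
  exact integral_mono (hint.sub htr).abs (hmoment.div_const _) fun x => abs_sub_truncate_le ht hε x

open scoped Matrix.Norms.L2Operator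

lemma opNorm_le_card_mul {α β : Type*} [Fintype α] [Fintype β] [DecidableEq β] (b : ℝ) {N : ℝ}
    (hα : (Fintype.card α : ℝ) ≤ N) (hβ : (Fintype.card β : ℝ) ≤ N) :
    ‖(Matrix.of fun _ _ => b : Matrix α β ℝ)‖ ^ 2 ≤ b ^ 2 * N ^ 2 := by
  refine (opNorm_sq_le_sum_sq _).trans ?_
  simp only [Matrix.of_apply, Finset.sum_const, Finset.card_univ, nsmul_eq_mul]
  have : (Fintype.card α : ℝ) * Fintype.card β ≤ N * N :=
    mul_le_mul hα hβ (by positivity) (le_trans (by positivity) hα)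
  nlinarith [sq_nonneg b]

/-- A crude bound, through the Frobenius norm. -/
lemma measure_opNorm_sq_gt_le_of_frobenius (hε : 0 < ε)
    (hmoment : Integrable (fun x : ℝ => |x| ^ (4 + ε)) ν)
    (hmean : ∫ x, x ∂ν = 0) (hvar : variance id ν = s ^ 2)
    {Ω : Type*} [MeasurableSpace Ω] {P : Measure Ω}
    [IsProbabilityMeasure P] {α β : Type*} [Fintype α] [Fintype β] [DecidableEq β] {X : α × β → Ω → ℝ}
    (hlaw : ∀ e, HasLaw (X e) ν P) {c : ℝ} (hc : 0 < c) :
    P {ω | c < ‖(Matrix.of fun a b => X (a, b) ω : Matrix α β ℝ)‖ ^ 2} ≤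
      ENNReal.ofReal (Fintype.card α * Fintype.card β * s ^ 2 / c) := by
  have hsq : ∀ e, ∫ ω, X e ω ^ 2 ∂P = s ^ 2 := fun e => by
    rw [← integral_sq_eq hε hmoment hmean hvar]
    exact (hlaw e).integral_comp (f := fun x : ℝ => x ^ 2)
      (measurable_id.pow_const 2).aestronglyMeasurable
  have hint : ∀ e, Integrable (fun ω => X e ω ^ 2) P := fun e => by
    have h := integrable_pow_of_moment (m := 2) hε hmoment (by norm_num)
    rw [← (hlaw e).map_eq] at h
    exact h.comp_aemeasurable (hlaw e).aemeasurable
  have hmarkov := mul_meas_ge_le_integral_of_nonneg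
    (Eventually.of_forall fun ω => (by positivity : 0 ≤ ∑ a, ∑ b, X (a, b) ω ^ 2))
    (integrable_finsetSum _ fun a _ => integrable_finsetSum _ fun b _ => hint (a, b)) c
  rw [integral_finsetSum _ fun a _ => integrable_finsetSum _ fun b _ => hint (a, b)] at hmarkov
  simp_rw [integral_finsetSum _ fun b _ => hint (_, b), hsq] at hmarkov
  have hsub : {ω | c < ‖(Matrix.of fun a b => X (a, b) ω : Matrix α β ℝ)‖ ^ 2} ⊆
      {ω | c ≤ ∑ a, ∑ b, X (a, b) ω ^ 2} := fun ω hω =>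
    (le_of_lt hω).trans (opNorm_sq_le_sum_sq _)
  refine (measure_mono hsub).trans ?_
  rw [← ofReal_measureReal]
  refine ENNReal.ofReal_le_ofReal ?_
  rw [le_div_iff₀ hc, mul_comm]
  refine hmarkov.trans (le_of_eq ?_)
  simp [mul_assoc]

/-- Reduction of the norm bound to the moment bound by truncation and centring. -/
lemma measure_opNorm_sq_gt_le_of_moment (hε : 0 < ε)
    (hmoment : Integrable (fun x : ℝ => |x| ^ (4 + ε)) ν)
    (hmean : ∫ x, x ∂ν = 0) (hvar : variance id ν = s ^ 2)
    {Ω : Type*} [MeasurableSpace Ω] {P : Measure Ω} [IsProbabilityMeasure P]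
    {α β : Type*} [Fintype α] [Fintype β] [DecidableEq α] [DecidableEq β] {X : α × β → Ω → ℝ}
    (hlaw : ∀ e, HasLaw (X e) ν P) (hind : iIndepFun X P) {N : ℝ} (hN : 0 < N)
    (hα : (Fintype.card α : ℝ) ≤ N) (hβ : (Fintype.card β : ℝ) ≤ N) {p : ℕ}
    (hp4 : 4 * 2 ^ (p + 1) ≤ N) (hp3 : ((2 : ℝ) ^ (p + 1)) ^ 3 ≤ N ^ 2)
    (hNp : N ≤ 2 ^ 2 ^ (p + 1)) :
    P {ω | (8 * (|s| + 1) ^ 2 * walkConst + 128 * (∫ x, |x| ^ (4 + ε) ∂ν) ^ 2) * N <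
        ‖(Matrix.of fun a b => X (a, b) ω : Matrix α β ℝ)‖ ^ 2} ≤
      ENNReal.ofReal
        ((∫ x, |x| ^ (4 + ε) ∂ν) * N ^ 2 * (4 * 2 ^ (p + 1) / N) ^ (2 + ε / 2)) +
      ENNReal.ofReal (4 / N) := by
  set M := ∫ x, |x| ^ (4 + ε) ∂ν with hM
  have hM0 : 0 ≤ M := integral_nonneg fun x => by positivity
  set k : ℝ := 2 ^ (p + 1) with hk
  have hk0 : 0 < k := by positivity
  -- Chosen so that `k * K ^ 2 = N`, the largest dimension the moment method admits. Below,
  -- truncation is at `K / 2` because centring can double the bound.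
  set K : ℝ := √(N / k) with hKdef
  have hK2 : K ^ 2 = N / k := Real.sq_sqrt (by positivity)
  have hkK : k * K ^ 2 = N := by rw [hK2]; field_simp
  have hK : 2 ≤ K := by
    refine Real.le_sqrt_of_sq_le ?_
    rw [le_div_iff₀ hk0]
    linarith
  set t := K / 2 with ht
  have ht1 : 1 ≤ t := by rw [ht]; linarith
  have ht2 : t ^ 2 = N / (4 * k) := by rw [ht, div_pow, hK2]; field_simp; norm_num
  set b := ∫ x, truncate t x ∂ν with hb
  have hbM : |b| ≤ M / t ^ 3 := abs_integral_truncate_le hε hmoment hmean ht1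
  have hbt : |b| ≤ t := by
    have := norm_integral_le_of_norm_le_const (μ := ν) (f := truncate t) (C := t)
      (Eventually.of_forall fun x => abs_truncate_le (by linarith) x)
    simpa using this
  -- Dividing by `c₀` makes the variance at most one; the added `1` keeps `c₀ ≥ 1` when `s` is small
  -- or zero.
  set c₀ := |s| + 1 with hc₀
  have hc1 : 1 ≤ c₀ := by rw [hc₀]; linarith [abs_nonneg s]
  set g : ℝ → ℝ := fun x => (truncate t x - b) / c₀ with hg
  have hgm : Measurable g := ((measurable_truncate t).sub_const b).div_const c₀
  have hgK : ∀ x, |g x| ≤ K := by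
    intro x
    rw [hg, abs_div, abs_of_pos (by linarith : 0 < c₀), div_le_iff₀ (by linarith)]
    have h1 := abs_sub (truncate t x) b
    have h2 := abs_truncate_le (by linarith : 0 ≤ t) x
    nlinarith
  have htr : Integrable (truncate t) ν :=
    integrable_of_abs_le (measurable_truncate t) (abs_truncate_le (by linarith))
  have hg0 : ∫ x, g x ∂ν = 0 := by
    rw [hg, integral_div, integral_sub htr (integrable_const b)]
    simp [← hb]
  have hg2 : ∫ x, g x ^ 2 ∂ν ≤ 1 := by
    have htr2 : Integrable (fun x => truncate t x ^ 2) ν :=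
      integrable_of_abs_le (c := t ^ 2) ((measurable_truncate t).pow_const 2) fun x => by
        rw [abs_pow]; exact pow_le_pow_left₀ (abs_nonneg _) (abs_truncate_le (by linarith) x) 2
    have e1 : ∀ x, g x ^ 2 = (truncate t x ^ 2 - 2 * b * truncate t x + b ^ 2) / c₀ ^ 2 := by
      intro x; rw [hg, div_pow]; ring
    simp_rw [e1]
    have hlin : Integrable (fun x => 2 * b * truncate t x) ν := htr.const_mul _
    have hsub : Integrable (fun x => truncate t x ^ 2 - 2 * b * truncate t x) ν := htr2.sub hlin
    rw [integral_div, integral_add hsub (integrable_const _), integral_sub htr2 hlin,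
      integral_const_mul, ← hb]
    have e2 : ∫ x, truncate t x ^ 2 ∂ν ≤ s ^ 2 := by
      rw [← integral_sq_eq hε hmoment hmean hvar]
      exact integral_mono htr2 (integrable_pow_of_moment hε hmoment (by norm_num))
        (truncate_sq_le t)
    rw [div_le_one (by positivity)]
    simp only [integral_const, probReal_univ, one_smul]
    have e3 : s ^ 2 ≤ c₀ ^ 2 := by
      rw [← sq_abs s]; exact pow_le_pow_left₀ (abs_nonneg s) (by linarith) 2
    nlinarith [sq_nonneg b]
  set A : α × β → Ω → ℝ := fun e ω => g (X e ω) with hA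
  have hAm : ∀ e, AEMeasurable (A e) P := fun e => hgm.comp_aemeasurable (hlaw e).aemeasurable
  have hAind : iIndepFun A P := hind.comp (fun _ => g) fun _ => hgm
  have hA0 : ∀ e, ∫ ω, A e ω ∂P = 0 := fun e =>
    ((hlaw e).integral_comp hgm.aestronglyMeasurable).trans hg0
  have hA2 : ∀ e, ∫ ω, A e ω ^ 2 ∂P ≤ 1 := fun e =>
    ((hlaw e).integral_comp (f := fun x => g x ^ 2)
      (hgm.pow_const 2).aestronglyMeasurable).trans_le hg2
  have hnorm := measure_opNorm_sq_gt_le hAm hAind (by linarith : 1 ≤ K)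
    (fun e ω => hgK (X e ω)) hA0 hA2 p (by rw [← hk, hkK]; exact hα) (by rw [← hk, hkK]; exact hβ)
  rw [← hk, hkK] at hnorm
  -- This controls the constant matrix removed by centring: `|b| ≤ M / t ^ 3` with `t ^ 2 = N / (4 *
  -- k)`, and then `k ^ 3 ≤ N ^ 2`.
  have hbN : b ^ 2 * N ^ 2 ≤ 64 * M ^ 2 * N := by
    have h1 : b ^ 2 ≤ (M / t ^ 3) ^ 2 := by
      rw [← sq_abs b]; exact pow_le_pow_left₀ (abs_nonneg b) hbM 2
    have h2 : (M / t ^ 3) ^ 2 = 64 * M ^ 2 * k ^ 3 / N ^ 3 := by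
      rw [div_pow, ← pow_mul, mul_comm 3 2, pow_mul, ht2]
      field_simp
      norm_num
    calc b ^ 2 * N ^ 2 ≤ (64 * M ^ 2 * k ^ 3 / N ^ 3) * N ^ 2 := by
          rw [← h2]; exact mul_le_mul_of_nonneg_right h1 (by positivity)
      _ = 64 * M ^ 2 * (k ^ 3 / N) := by field_simp
      _ ≤ 64 * M ^ 2 * N := by
          refine mul_le_mul_of_nonneg_left ?_ (by positivity)
          rw [div_le_iff₀ hN]; linarith
  have hsub : {ω | (8 * c₀ ^ 2 * walkConst + 128 * M ^ 2) * N <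
        ‖(Matrix.of fun a b => X (a, b) ω : Matrix α β ℝ)‖ ^ 2} ⊆
      (⋃ e, {ω | t < |X e ω|}) ∪ {ω | 4 * walkConst * N <
        ‖(Matrix.of fun a b => A (a, b) ω : Matrix α β ℝ)‖ ^ 2} := by
    intro ω hω
    by_contra hcon
    simp only [Set.mem_union, Set.mem_iUnion, Set.mem_ofPred_eq, not_or, not_exists, not_lt]
      at hcon hω
    obtain ⟨hX, hA'⟩ := hcon
    -- Off the exceptional events no entry is truncated, so `X = c₀ • A + b`; the constants `8` and
    -- `128` come from `(c₀ * y + z) ^ 2 ≤ 2 * (c₀ * y) ^ 2 + 2 * z ^ 2`.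
    have hdec : (Matrix.of fun a b => X (a, b) ω : Matrix α β ℝ) =
        c₀ • (Matrix.of fun a b => A (a, b) ω : Matrix α β ℝ) + Matrix.of fun _ _ => b := by
      ext i j
      simp only [Matrix.of_apply, Matrix.add_apply, Matrix.smul_apply, smul_eq_mul, hA, hg]
      rw [mul_div_cancel₀ _ (by linarith : c₀ ≠ 0), truncate, if_pos (hX (i, j))]
      ring
    have hB := opNorm_le_card_mul (α := α) (β := β) b hα hβ
    have htri := norm_add_le (c₀ • (Matrix.of fun a b => A (a, b) ω : Matrix α β ℝ))
      (Matrix.of fun _ _ => b)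
    rw [← hdec, norm_smul, Real.norm_of_nonneg (by linarith : 0 ≤ c₀)] at htri
    set x := ‖(Matrix.of fun a b => X (a, b) ω : Matrix α β ℝ)‖
    set y := ‖(Matrix.of fun a b => A (a, b) ω : Matrix α β ℝ)‖
    set z := ‖(Matrix.of fun _ _ => b : Matrix α β ℝ)‖
    have hx0 : 0 ≤ x := norm_nonneg _
    have h1 : x ^ 2 ≤ (c₀ * y + z) ^ 2 := pow_le_pow_left₀ hx0 htri 2
    have h2 : c₀ ^ 2 * y ^ 2 ≤ c₀ ^ 2 * (4 * walkConst * N) :=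
      mul_le_mul_of_nonneg_left hA' (sq_nonneg _)
    nlinarith [sq_nonneg (c₀ * y - z)]
  refine (measure_mono hsub).trans ((measure_union_le _ _).trans (add_le_add ?_ ?_))
  · have hq : 0 < 4 + ε := by linarith
    have hpow : t ^ (4 + ε) = (N / (4 * k)) ^ (2 + ε / 2) := by
      rw [← ht2, ← Real.rpow_natCast, ← Real.rpow_mul (by linarith)]
      congr 1; push_cast; ring
    have he : ∀ e, P {ω | t < |X e ω|} ≤ ENNReal.ofReal (M / t ^ (4 + ε)) := fun e => by
      rw [(hlaw e).measure_eq (p := fun x => t < |x|)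
        (measurableSet_lt measurable_const measurable_norm)]
      exact measure_abs_gt_le hq hmoment (by linarith)
    calc P (⋃ e, {ω | t < |X e ω|}) ≤ ∑ e, P {ω | t < |X e ω|} := measure_iUnion_fintype_le _ _
      _ ≤ ∑ _e : α × β, ENNReal.ofReal (M / t ^ (4 + ε)) := Finset.sum_le_sum fun e _ => he e
      _ = ENNReal.ofReal (Fintype.card α * Fintype.card β * (M / t ^ (4 + ε))) := by
          rw [Finset.sum_const, Finset.card_univ, Fintype.card_prod, nsmul_eq_mul,
            ENNReal.ofReal_mul (by positivity)]
          congr 1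
          rw [← Nat.cast_mul, ENNReal.ofReal_natCast]
      _ ≤ _ := by
          refine ENNReal.ofReal_le_ofReal ?_
          have h1 : (Fintype.card α : ℝ) * Fintype.card β ≤ N * N :=
            mul_le_mul hα hβ (by positivity) hN.le
          have h2 : M / t ^ (4 + ε) = M * (4 * k / N) ^ (2 + ε / 2) := by
            rw [hpow, ← inv_div N, Real.inv_rpow (by positivity), div_eq_mul_inv]
          rw [h2]
          calc _ ≤ N * N * (M * (4 * k / N) ^ (2 + ε / 2)) :=
                mul_le_mul_of_nonneg_right h1 (by positivity)
            _ = _ := by ring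
  · refine hnorm.trans (ENNReal.ofReal_le_ofReal ?_)
    have h1 : N ^ 2 ≤ 4 ^ 2 ^ (p + 1) := by
      calc N ^ 2 ≤ (2 ^ 2 ^ (p + 1)) ^ 2 := pow_le_pow_left₀ hN.le hNp 2
        _ = _ := by rw [← pow_mul, mul_comm, pow_mul]; norm_num
    calc 4 * N / 4 ^ 2 ^ (p + 1) ≤ 4 * N / N ^ 2 := by gcongr
      _ = 4 / N := by field_simp

universe u in
/-- The operator norm of a matrix with independent, identically distributed, centred entries with
a moment of order larger than four is at most of the order of the square root of its larger
dimension, uniformly in the dimensions. -/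
theorem exists_opNorm_sq_bound (hε : 0 < ε)
    (hmoment : Integrable (fun x : ℝ => |x| ^ (4 + ε)) ν)
    (hmean : ∫ x, x ∂ν = 0) (hvar : variance id ν = s ^ 2) {δ : ℝ} (hδ : 0 < δ) :
    ∃ C : ℝ, 0 < C ∧ ∀ {Ω : Type u} [MeasurableSpace Ω] (P : Measure Ω)
      [IsProbabilityMeasure P] {α β : Type} [Fintype α] [Fintype β] [DecidableEq α]
      [DecidableEq β] (X : α × β → Ω → ℝ), (∀ e, HasLaw (X e) ν P) → iIndepFun X P →
      ∀ N : ℕ, 0 < N → Fintype.card α ≤ N → Fintype.card β ≤ N →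
      P {ω | C * N < ‖(Matrix.of fun a b => X (a, b) ω : Matrix α β ℝ)‖ ^ 2} ≤
        ENNReal.ofReal δ := by
  set M := ∫ x, |x| ^ (4 + ε) ∂ν with hM
  have hM0 : 0 ≤ M := integral_nonneg fun x => by positivity
  obtain ⟨N₀, hN₀⟩ := eventually_atTop.1
    (eventually_exists_power_of_two hε (by positivity : 0 < δ / 2) hM0)
  set C₁ := 8 * (|s| + 1) ^ 2 * walkConst + 128 * M ^ 2 with hC₁
  -- The dimensions need not grow, so `N ≤ N₀` has to be covered too: `C₂` makes the Frobenius bound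
  -- at most `δ` there, while `C₁` serves `N ≥ N₀`.
  set C₂ := (N₀ * s ^ 2 + 1) / δ with hC₂
  have hw := walkConst_pos
  have hC₁0 : 0 < C₁ := by positivity
  have hC₂0 : 0 < C₂ := by positivity
  refine ⟨C₁ + C₂, by positivity, ?_⟩
  intro Ω _ P _ α β _ _ _ _ X hlaw hind N hN hα hβ
  have hNr : (0 : ℝ) < N := by exact_mod_cast hN
  have hαr : (Fintype.card α : ℝ) ≤ N := by exact_mod_cast hα
  have hβr : (Fintype.card β : ℝ) ≤ N := by exact_mod_cast hβ
  rcases le_total N₀ N with h | h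
  · obtain ⟨p, h1, h2, h3, h4, h5⟩ := hN₀ N h
    calc P {ω | (C₁ + C₂) * N < ‖(Matrix.of fun a b => X (a, b) ω : Matrix α β ℝ)‖ ^ 2}
        ≤ P {ω | C₁ * N < ‖(Matrix.of fun a b => X (a, b) ω : Matrix α β ℝ)‖ ^ 2} := by
          refine measure_mono fun ω hω => ?_
          refine lt_of_le_of_lt (b := (C₁ + C₂) * N) ?_ hω
          exact mul_le_mul_of_nonneg_right (by linarith) hNr.le
      _ ≤ _ := measure_opNorm_sq_gt_le_of_moment hε hmoment hmean hvar hlaw hind hNr hαr hβr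
          h1 h2 h3
      _ ≤ ENNReal.ofReal (δ / 2) + ENNReal.ofReal (δ / 2) :=
          add_le_add (ENNReal.ofReal_le_ofReal h4) (ENNReal.ofReal_le_ofReal h5)
      _ = ENNReal.ofReal δ := by
          rw [← ENNReal.ofReal_add (by positivity) (by positivity), add_halves]
  · refine (measure_opNorm_sq_gt_le_of_frobenius hε hmoment hmean hvar hlaw
      (by positivity : 0 < (C₁ + C₂) * N)).trans (ENNReal.ofReal_le_ofReal ?_)
    have hNN : (N : ℝ) ≤ N₀ := by exact_mod_cast h
    rw [div_le_iff₀ (by positivity)]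
    calc (Fintype.card α : ℝ) * Fintype.card β * s ^ 2 ≤ N * N₀ * s ^ 2 := by
          gcongr
          exact hβ.trans h
      _ ≤ (δ * C₂) * N := by
          rw [hC₂, mul_div_cancel₀ _ hδ.ne']
          nlinarith
      _ ≤ δ * ((C₁ + C₂) * N) := by
          have := mul_pos (mul_pos hδ hC₁0) hNr
          nlinarith

end IIDMatrix

/-! ### Eigenvalue and eigenvector perturbation. -/

section Perturbation

variable {E : Type*} [NormedAddCommGroup E] [InnerProductSpace ℝ E]

/-- Finitely many linear constraints can be met by a combination of a larger initial segment. -/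
lemma exists_combination_orthogonal {R : ℕ} (m : Fin R → E) (r : Fin R) (w : Fin (r : ℕ) → E) :
    ∃ c : Fin R → ℝ, c ≠ 0 ∧ (∀ i, r < i → c i = 0) ∧
      ∀ i, inner ℝ (w i) (∑ k, c k • m k) = 0 := by
  let L : (Fin R → ℝ) →ₗ[ℝ] ({i : Fin R // r < i} → ℝ) × (Fin (r : ℕ) → ℝ) :=
    LinearMap.prod (LinearMap.pi fun i => LinearMap.proj i.1)
      (LinearMap.pi fun i => (innerₗ E (w i)) ∘ₗ Fintype.linearCombination ℝ m)
  -- There are `R` unknowns and `(R - 1 - r) + r = R - 1` linear constraints.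
  have hker : LinearMap.ker L ≠ ⊥ := by
    refine LinearMap.ker_ne_bot_of_finrank_lt ?_
    have hc : Fintype.card {i : Fin R // r < i} = R - 1 - r := by
      rw [Fintype.card_subtype, ← Fin.card_Ioi]
      congr 1
      ext i
      simp
    have := r.2
    rw [Module.finrank_prod, Module.finrank_fintype_fun_eq_card,
      Module.finrank_fintype_fun_eq_card, Module.finrank_fintype_fun_eq_card, hc,
      Fintype.card_fin, Fintype.card_fin]
    omega
  obtain ⟨c, hc, hc0⟩ := (Submodule.ne_bot_iff _).1 hker
  have hL : L c = 0 := hc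
  refine ⟨c, hc0, fun i hi => congrFun (congrArg Prod.fst hL) ⟨i, hi⟩, fun i => ?_⟩
  exact congrFun (congrArg Prod.snd hL) i

lemma norm_sum_smul_sq {κ : Type*} [Fintype κ] {m : κ → E} (hm : Orthonormal ℝ m) (c : κ → ℝ) :
    ‖∑ k, c k • m k‖ ^ 2 = ∑ k, c k ^ 2 := by
  rw [← real_inner_self_eq_norm_sq, hm.inner_sum]
  simp [sq]

/-- Weyl's inequality for a perturbation of a spectral sum. -/
lemma abs_eigenvalue_sub_le {n R : ℕ} (b : OrthonormalBasis (Fin n) ℝ E) {T : E → E}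
    {l : Fin n → ℝ} (hl : Antitone l)
    (hT : ∀ x, inner ℝ x (T x) = ∑ i, l i * inner ℝ (b i) x ^ 2)
    {m : Fin R → E} (hm : Orthonormal ℝ m) {τ : Fin R → ℝ} (hτ : Antitone τ) (hτ0 : ∀ i, 0 ≤ τ i)
    {ρ : ℝ} (hρ : ∀ x, |inner ℝ x (T x) - ∑ i, τ i * inner ℝ (m i) x ^ 2| ≤ ρ * ‖x‖ ^ 2)
    (r : Fin R) (hr : (r : ℕ) < n) : |l ⟨r, hr⟩ - τ r| ≤ ρ := by
  have hb : ∀ x, ∑ i, inner ℝ (b i) x ^ 2 = ‖x‖ ^ 2 := fun x => b.sum_sq_inner_right x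
  rw [abs_le]
  constructor
  -- Courant–Fischer by a test vector: `x` lies in the span of `m 0, …, m r` and is orthogonal to
  -- the first `r` eigenvectors, so its quadratic form is at most `l r` and nearly at least `τ r`.
  -- The other direction exchanges the two families.
  · obtain ⟨c, hc0, hcr, hcw⟩ := exists_combination_orthogonal m r
      fun i => b ⟨i, i.2.trans hr⟩
    set x := ∑ k, c k • m k with hx
    have hmx : ∀ i, inner ℝ (m i) x = c i := fun i => hm.inner_right_fintype c i
    have hxn : ‖x‖ ^ 2 = ∑ i, c i ^ 2 := norm_sum_smul_sq hm c
    have hxpos : 0 < ‖x‖ ^ 2 := by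
      rw [hxn]
      obtain ⟨i, hi⟩ := Function.ne_iff.1 hc0
      exact Finset.sum_pos' (fun _ _ => sq_nonneg _) ⟨i, Finset.mem_univ _, by
        have : c i ≠ 0 := hi
        positivity⟩
    have h1 : inner ℝ x (T x) ≤ l ⟨r, hr⟩ * ‖x‖ ^ 2 := by
      rw [hT, ← hb, Finset.mul_sum]
      refine Finset.sum_le_sum fun i _ => ?_
      rcases lt_or_ge (i : ℕ) r with h | h
      · have : inner ℝ (b i) x = 0 := hcw ⟨i, h⟩
        simp [this]
      · exact mul_le_mul_of_nonneg_right (hl (Fin.le_def.2 h)) (sq_nonneg _)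
    have h2 : τ r * ‖x‖ ^ 2 ≤ ∑ i, τ i * inner ℝ (m i) x ^ 2 := by
      rw [hxn, Finset.mul_sum]
      refine Finset.sum_le_sum fun i _ => ?_
      rw [hmx]
      rcases lt_or_ge r i with h | h
      · simp [hcr i h]
      · exact mul_le_mul_of_nonneg_right (hτ h) (sq_nonneg _)
    have h3 := (abs_le.1 (hρ x)).1
    refine le_of_mul_le_mul_right ?_ hxpos
    linarith
  · obtain ⟨c, hc0, hcr, hcw⟩ := exists_combination_orthogonal b ⟨r, hr⟩
      fun i => m ⟨i, i.2.trans r.2⟩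
    set x := ∑ k, c k • b k with hx
    have hbx : ∀ i, inner ℝ (b i) x = c i := fun i => b.orthonormal.inner_right_fintype c i
    have hxn : ‖x‖ ^ 2 = ∑ i, c i ^ 2 := norm_sum_smul_sq b.orthonormal c
    have hxpos : 0 < ‖x‖ ^ 2 := by
      rw [hxn]
      obtain ⟨i, hi⟩ := Function.ne_iff.1 hc0
      exact Finset.sum_pos' (fun _ _ => sq_nonneg _) ⟨i, Finset.mem_univ _, by
        have : c i ≠ 0 := hi
        positivity⟩
    have h1 : l ⟨r, hr⟩ * ‖x‖ ^ 2 ≤ inner ℝ x (T x) := by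
      rw [hT, hxn, Finset.mul_sum]
      refine Finset.sum_le_sum fun i _ => ?_
      rw [hbx]
      rcases lt_or_ge ⟨r, hr⟩ i with h | h
      · simp [hcr i h]
      · exact mul_le_mul_of_nonneg_right (hl h) (sq_nonneg _)
    have h2 : ∑ i, τ i * inner ℝ (m i) x ^ 2 ≤ τ r * ‖x‖ ^ 2 := by
      have hbessel : ∑ i, inner ℝ (m i) x ^ 2 ≤ ‖x‖ ^ 2 := by
        have := hm.sum_inner_products_le x (s := Finset.univ)
        simpa using this
      -- The family `m` need not span; off its span the spectral sum is zero, and `τ r ≥ 0` with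
      -- Bessel's inequality covers that part.
      refine le_trans ?_ (mul_le_mul_of_nonneg_left hbessel (hτ0 r))
      rw [Finset.mul_sum]
      refine Finset.sum_le_sum fun i _ => ?_
      rcases lt_or_ge i r with h | h
      · have : inner ℝ (m i) x = 0 := hcw ⟨i, h⟩
        simp [this]
      · exact mul_le_mul_of_nonneg_right (hτ h) (sq_nonneg _)
    have h3 := (abs_le.1 (hρ x)).2
    refine le_of_mul_le_mul_right ?_ hxpos
    linarith

/-- Pythagoras for an orthonormal family and a vector orthogonal to it. -/
lemma norm_sum_smul_add_smul_sq {κ : Type*} [Fintype κ] {m : κ → E} (hm : Orthonormal ℝ m)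
    (c : κ → ℝ) {q : E} (hq : ∀ k, inner ℝ (m k) q = 0) (t : ℝ) :
    ‖∑ k, c k • m k + t • q‖ ^ 2 = ∑ k, c k ^ 2 + t ^ 2 * ‖q‖ ^ 2 := by
  have h : inner ℝ (∑ k, c k • m k) (t • q) = 0 := by
    simp [sum_inner, inner_smul_left, inner_smul_right, hq]
  rw [norm_add_sq_real, h, norm_sum_smul_sq hm, norm_smul, mul_pow, Real.norm_eq_abs, sq_abs]
  ring

/-- A Davis–Kahan type bound: an approximate eigenvector of a spectral sum is close to the
corresponding vector of the sum. -/
lemma norm_sub_mul_gap_le {R : ℕ} {m : Fin R → E} (hm : Orthonormal ℝ m) {τ : Fin R → ℝ}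
    {r : Fin R} {δ θ : ℝ} (hδ : 0 ≤ δ) (hgap : ∀ k, k ≠ r → δ ≤ |τ k - τ r|) (hgap0 : δ ≤ |τ r|)
    {x : E} (hx : ‖x‖ = 1) (hsign : 0 ≤ inner ℝ x (m r))
    (hres : ‖∑ k, (τ k * inner ℝ (m k) x) • m k - τ r • x‖ ≤ θ) :
    ‖x - m r‖ * δ ≤ √2 * θ := by
  set a : Fin R → ℝ := fun k => inner ℝ (m k) x with ha
  set q := x - ∑ k, a k • m k with hq
  have hqm : ∀ k, inner ℝ (m k) q = 0 := fun k => by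
    rw [hq, inner_sub_right, hm.inner_right_fintype, sub_self]
  -- In orthogonal coordinates every component except the one along `m r` is multiplied by at least
  -- `δ` in absolute value. The part `q` outside the span carries the eigenvalue zero, which is why
  -- the gap to zero is needed.
  have hz : ∑ k, (τ k * inner ℝ (m k) x) • m k - τ r • x =
      ∑ k, ((τ k - τ r) * a k) • m k + (-τ r) • q := by
    rw [hq]
    simp only [sub_mul, sub_smul, Finset.sum_sub_distrib, mul_smul, ← Finset.smul_sum, smul_sub,
      neg_smul, ha]
    abel
  have hzn : ‖∑ k, (τ k * inner ℝ (m k) x) • m k - τ r • x‖ ^ 2 =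
      ∑ k, ((τ k - τ r) * a k) ^ 2 + (-τ r) ^ 2 * ‖q‖ ^ 2 := by
    rw [hz, norm_sum_smul_add_smul_sq hm _ hqm]
  have hxn : 1 = ∑ k, a k ^ 2 + ‖q‖ ^ 2 := by
    have := norm_sum_smul_add_smul_sq hm a hqm 1
    rw [one_smul, hq, add_sub_cancel, hx] at this
    simpa using this
  have har : 0 ≤ a r := by rw [ha]; simp only; rwa [real_inner_comm]
  have hlow : δ ^ 2 * (1 - a r ^ 2) ≤ θ ^ 2 := by
    refine le_trans ?_ (pow_le_pow_left₀ (norm_nonneg _) hres 2)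
    rw [hzn, hxn, ← Finset.add_sum_erase _ _ (Finset.mem_univ r),
      ← Finset.add_sum_erase _ (fun k => ((τ k - τ r) * a k) ^ 2) (Finset.mem_univ r)]
    have h1 : δ ^ 2 * ∑ k ∈ Finset.univ.erase r, a k ^ 2 ≤
        ∑ k ∈ Finset.univ.erase r, ((τ k - τ r) * a k) ^ 2 := by
      rw [Finset.mul_sum]
      refine Finset.sum_le_sum fun k hk => ?_
      rw [mul_pow, ← sq_abs (τ k - τ r)]
      exact mul_le_mul_of_nonneg_right
        (pow_le_pow_left₀ hδ (hgap k (Finset.ne_of_mem_erase hk)) 2) (sq_nonneg _)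
    have h2 : δ ^ 2 * ‖q‖ ^ 2 ≤ (-τ r) ^ 2 * ‖q‖ ^ 2 := by
      rw [neg_sq, ← sq_abs (τ r)]
      exact mul_le_mul_of_nonneg_right (pow_le_pow_left₀ hδ hgap0 2) (sq_nonneg _)
    rw [sub_self, zero_mul]
    nlinarith
  have hle : a r ≤ 1 := by
    have h1 : a r ^ 2 ≤ ∑ k, a k ^ 2 :=
      Finset.single_le_sum (f := fun k => a k ^ 2) (fun k _ => sq_nonneg _) (Finset.mem_univ r)
    nlinarith [sq_nonneg ‖q‖]
  have hdist : ‖x - m r‖ ^ 2 = 2 - 2 * a r := by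
    rw [norm_sub_sq_real, hx, hm.1 r, real_inner_comm]
    ring
  have hθ : 0 ≤ θ := (norm_nonneg _).trans hres
  refine (pow_le_pow_iff_left₀ (by positivity) (by positivity) two_ne_zero).1 ?_
  rw [mul_pow, mul_pow, Real.sq_sqrt (by norm_num), hdist]
  -- The sign choice gives `0 ≤ a r ≤ 1`, hence `2 - 2 * a r ≤ 2 * (1 - a r ^ 2)`.
  nlinarith [mul_nonneg (sq_nonneg δ) (mul_nonneg har (sub_nonneg.2 hle))]

open scoped Matrix.Norms.L2Operator

/-- Perturbation bound for the eigenvectors of a symmetric matrix. -/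
lemma norm_sub_mul_gap_le_of_isUnitEigenvector {n R : ℕ} {A S : Matrix (Fin n) (Fin n) ℝ}
    {m : Fin R → EuclideanSpace ℝ (Fin n)} (hm : Orthonormal ℝ m) {τ : Fin R → ℝ}
    (hτ : Antitone τ) (hτ0 : ∀ i, 0 ≤ τ i)
    (hS : ∀ x : EuclideanSpace ℝ (Fin n),
      (WithLp.toLp 2 (S.mulVec x.ofLp) : EuclideanSpace ℝ (Fin n)) =
        ∑ k, (τ k * inner ℝ (m k) x) • m k)
    {ρ : ℝ} (hρ : ‖A - S‖ ≤ ρ) {r : Fin R} {δ : ℝ} (hδ : 0 ≤ δ)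
    (hgap : ∀ k, k ≠ r → δ ≤ |τ k - τ r|) (hgap0 : δ ≤ |τ r|)
    {x : EuclideanSpace ℝ (Fin n)} (hx : IsUnitEigenvector A r x)
    (hsign : 0 ≤ inner ℝ x (m r)) : ‖x - m r‖ * δ ≤ 3 * ρ := by
  obtain ⟨hx1, hA, hk, heig⟩ := hx
  have hρ0 : 0 ≤ ρ := (norm_nonneg _).trans hρ
  have hsym := Matrix.isSymmetric_toEuclideanLin_iff.mpr hA
  set b := hsym.eigenvectorBasis finrank_euclideanSpace with hb
  set T : EuclideanSpace ℝ (Fin n) → EuclideanSpace ℝ (Fin n) :=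
    fun y => WithLp.toLp 2 (A.mulVec y.ofLp) with hT
  have hTb : ∀ i, T (b i) = hA.eigenvalues₀ i • b i := fun i =>
    hsym.apply_eigenvectorBasis finrank_euclideanSpace i
  have hTsym : ∀ y z, inner ℝ (T y) z = inner ℝ y (T z) := fun y z => hsym y z
  have hTq : ∀ y, inner ℝ y (T y) = ∑ i, hA.eigenvalues₀ i * inner ℝ (b i) y ^ 2 := by
    intro y
    rw [← b.sum_inner_mul_inner y (T y)]
    refine Finset.sum_congr rfl fun i _ => ?_
    rw [← hTsym, hTb, inner_smul_left, real_inner_comm y]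
    simp only [conj_trivial]
    ring
  have hdiff : ∀ y, ‖T y - ∑ k, (τ k * inner ℝ (m k) y) • m k‖ ≤ ρ * ‖y‖ := by
    intro y
    rw [← hS, hT]
    refine le_trans ?_ ((norm_mulVec_le (A - S) y).trans
      (mul_le_mul_of_nonneg_right hρ (norm_nonneg _)))
    rw [Matrix.sub_mulVec]
    rfl
  have hform : ∀ y, |inner ℝ y (T y) - ∑ i, τ i * inner ℝ (m i) y ^ 2| ≤ ρ * ‖y‖ ^ 2 := by
    intro y
    have e1 : ∑ i, τ i * inner ℝ (m i) y ^ 2 =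
        inner ℝ y (∑ k, (τ k * inner ℝ (m k) y) • m k) := by
      rw [inner_sum]
      refine Finset.sum_congr rfl fun i _ => ?_
      rw [inner_smul_right, real_inner_comm y]
      ring
    rw [e1, ← inner_sub_right]
    refine (abs_real_inner_le_norm _ _).trans ?_
    have := mul_le_mul_of_nonneg_left (hdiff y) (norm_nonneg y)
    linarith
  have hweyl := abs_eigenvalue_sub_le b hA.eigenvalues₀_antitone hTq hm hτ hτ0 hform r hk
  have hTx : T x = hA.eigenvalues₀ ⟨r, hk⟩ • x := by
    rw [hT]
    simp only [heig]
    rfl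
  -- One `ρ` is the perturbation applied to `x`, the other is Weyl's bound for exchanging the
  -- eigenvalue with `τ r`. Only the gap of the unperturbed spectrum is thus needed.
  have hres : ‖∑ k, (τ k * inner ℝ (m k) x) • m k - τ r • x‖ ≤ 2 * ρ := by
    have e1 : ∑ k, (τ k * inner ℝ (m k) x) • m k - τ r • x =
        (hA.eigenvalues₀ ⟨r, hk⟩ - τ r) • x - (T x - ∑ k, (τ k * inner ℝ (m k) x) • m k) := by
      rw [hTx, sub_smul]; abel
    rw [e1]
    refine (norm_sub_le _ _).trans ?_
    have h1 := hdiff x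
    rw [norm_smul, hx1, mul_one, Real.norm_eq_abs]
    rw [hx1, mul_one] at h1
    linarith
  refine (norm_sub_mul_gap_le hm hδ hgap hgap0 hx1 hsign hres).trans ?_
  have : √2 ≤ 3 / 2 := by
    rw [Real.sqrt_le_left (by norm_num)]; norm_num
  nlinarith

end Perturbation

/-! ### Spectral structure of the unfolded signal and the deterministic error bound. -/

section ModelStructure

open scoped Matrix.Norms.L2Operator

variable {d : ℕ} {N : Fin d → ℕ} {R : ℕ} {v : Loadings N R}

lemma IsOrthogonal.inner_eq_zero (hv : IsOrthogonal v) (j : Fin d) {r r' : Fin R} (h : r ≠ r') :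
    inner ℝ (v j r) (v j r') = 0 := by
  have := hv.isDiag j h
  simpa [Matrix.mul_apply, loadingMatrix, PiLp.inner_apply, mul_comm] using this

lemma IsOrthogonal.orthonormal_normalized (hv : IsOrthogonal v) (j : Fin d) :
    Orthonormal ℝ (normalized v j) := by
  refine ⟨fun r => ?_, fun r r' h => ?_⟩
  · exact norm_smul_inv_norm (𝕜 := ℝ) (hv.ne_zero j r)
  · simp [normalized, inner_smul_left, inner_smul_right, hv.inner_eq_zero j h]

lemma IsOrthogonal.dim_pos (hv : IsOrthogonal v) (r : Fin R) (j : Fin d) : 0 < N j := by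
  rw [Nat.pos_iff_ne_zero]
  intro h
  refine hv.ne_zero j r ?_
  have : IsEmpty (Fin (N j)) := by rw [h]; infer_instance
  exact Subsingleton.elim _ _

lemma scale_nonneg (v : Loadings N R) (r : Fin R) : 0 ≤ scale v r :=
  Finset.prod_nonneg fun _ _ => norm_nonneg _

lemma trace_scaleMatrix (v : Loadings N R) : (scaleMatrix v).trace = ∑ r, scale v r := by
  simp [scaleMatrix, Matrix.trace_diagonal]

lemma gap_nonneg (v : Loadings N R) (r : Fin R) : 0 ≤ gap v r :=
  Real.iInf_nonneg fun _ => abs_nonneg _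

lemma gap_le_abs (v : Loadings N R) (r : Fin R) {k : ℕ} (hk : k ≠ r) :
    gap v r ≤ |scaleExt v k ^ 2 - scaleExt v r ^ 2| :=
  ciInf_le (f := fun k : {k : ℕ // k ≠ (r : ℕ)} => |scaleExt v k ^ 2 - scaleExt v r ^ 2|)
    ⟨0, by rintro _ ⟨k, rfl⟩; exact abs_nonneg _⟩ ⟨k, hk⟩

lemma scaleExt_coe (v : Loadings N R) (r : Fin R) : scaleExt v r = scale v r := by
  simp [scaleExt]

lemma gap_le_of_ne (v : Loadings N R) {r k : Fin R} (hk : k ≠ r) :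
    gap v r ≤ |scale v k ^ 2 - scale v r ^ 2| := by
  rw [← scaleExt_coe, ← scaleExt_coe]
  exact gap_le_abs v r fun h => hk (Fin.ext h)

lemma gap_le_sq (v : Loadings N R) (r : Fin R) : gap v r ≤ |scale v r ^ 2| := by
  -- The index `R` is the first one past the factors, where the extended scale is zero.
  have := gap_le_abs v r (k := R) r.2.ne'
  rw [scaleExt_coe] at this
  simpa [scaleExt] using this

/-- The Kronecker product of the normalized loadings in the modes different from `j`. -/
noncomputable def coNormalized (v : Loadings N R) (j : Fin d) (r : Fin R) :
    EuclideanSpace ℝ (∀ k : {k // k ≠ j}, Fin (N k)) :=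
  WithLp.toLp 2 fun b => ∏ k : {k // k ≠ j}, normalized v k r (b k)

lemma inner_coNormalized (v : Loadings N R) (j : Fin d) (r r' : Fin R) :
    inner ℝ (coNormalized v j r) (coNormalized v j r') =
      ∏ k : {k // k ≠ j}, inner ℝ (normalized v k r) (normalized v k r') := by
  simp only [PiLp.inner_apply]
  rw [Finset.prod_univ_sum]
  simp only [Fintype.piFinset_univ]
  refine Finset.sum_congr rfl fun b _ => ?_
  simp [coNormalized, Finset.prod_mul_distrib]

lemma IsOrthogonal.orthonormal_coNormalized (hv : IsOrthogonal v) (hd : 2 ≤ d) (j : Fin d) :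
    Orthonormal ℝ (coNormalized v j) := by
  classical
  rw [orthonormal_iff_ite]
  intro r r'
  rw [inner_coNormalized]
  have h : ∀ k : {k // k ≠ j}, inner ℝ (normalized v k r) (normalized v k r') =
      if r = r' then (1 : ℝ) else 0 := fun k =>
    orthonormal_iff_ite.1 (hv.orthonormal_normalized k) r r'
  simp_rw [h]
  split_ifs with hr
  · simp
  -- A mode other than `j` is needed to supply a vanishing factor; for `d = 1` the product would be
  -- empty.
  · have : Nontrivial (Fin d) := Fin.nontrivial_iff_two_le.2 hd
    obtain ⟨k, hk⟩ := exists_ne j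
    exact Finset.prod_eq_zero (Finset.mem_univ ⟨k, hk⟩) rfl

lemma smul_normalized (hv : IsOrthogonal v) (j : Fin d) (r : Fin R) (a : Fin (N j)) :
    v j r a = ‖v j r‖ * normalized v j r a := by
  have : ‖v j r‖ ≠ 0 := norm_ne_zero_iff.2 (hv.ne_zero j r)
  simp [normalized, this]

/-- The signal part of the unfolding is a singular value decomposition. -/
lemma unfold_observed (hv : IsOrthogonal v) (U : Tensor N) (j : Fin d) :
    unfold (observed v U) j =
      ∑ r, scale v r • Matrix.vecMulVec (normalized v j r).ofLp (coNormalized v j r).ofLp +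
        unfold U j := by
  ext a b
  simp only [unfold, observed, Matrix.of_apply, Matrix.add_apply, Matrix.sum_apply,
    Matrix.smul_apply, Matrix.vecMulVec_apply, smul_eq_mul]
  congr 1
  refine Finset.sum_congr rfl fun r _ => ?_
  have h1 : ∀ k, v k r ((Equiv.piSplitAt j fun k => Fin (N k)).symm (a, b) k) = ‖v k r‖ *
      normalized v k r ((Equiv.piSplitAt j fun k => Fin (N k)).symm (a, b) k) := fun k =>
    smul_normalized hv k r _
  simp_rw [h1]
  rw [Finset.prod_mul_distrib, scale]
  congr 1
  rw [Fintype.prod_eq_mul_prod_subtype_ne _ j]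
  congr 1
  · simp [Equiv.piSplitAt]
  · simp only [coNormalized]
    refine Finset.prod_congr rfl fun k _ => ?_
    simp [Equiv.piSplitAt, k.2]

lemma opNorm_vecMulVec_le {α β : Type*} [Fintype α] [Fintype β] [DecidableEq β]
    (x : EuclideanSpace ℝ α) (y : EuclideanSpace ℝ β) :
    ‖Matrix.vecMulVec x.ofLp y.ofLp‖ ≤ ‖x‖ * ‖y‖ := by
  refine (pow_le_pow_iff_left₀ (norm_nonneg _) (by positivity) two_ne_zero).1 ?_
  refine (opNorm_sq_le_sum_sq _).trans (le_of_eq ?_)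
  simp_rw [Matrix.vecMulVec_apply, mul_pow, ← Finset.mul_sum]
  rw [← Finset.sum_mul, EuclideanSpace.real_norm_sq_eq, EuclideanSpace.real_norm_sq_eq]

/-- The Gram matrix of signal plus noise is a perturbation of the Gram matrix of the signal. -/
lemma opNorm_gram_sub_le {α β : Type*} [Fintype α] [Fintype β] [DecidableEq α] [DecidableEq β]
    {m : Fin R → EuclideanSpace ℝ α} (hm : Orthonormal ℝ m)
    {w : Fin R → EuclideanSpace ℝ β} (hw : Orthonormal ℝ w) {σ : Fin R → ℝ} (hσ : ∀ r, 0 ≤ σ r)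
    (Z : Matrix α β ℝ) :
    ‖(∑ r, σ r • Matrix.vecMulVec (m r).ofLp (w r).ofLp + Z) *
        (∑ r, σ r • Matrix.vecMulVec (m r).ofLp (w r).ofLp + Z).transpose -
        ∑ r, σ r ^ 2 • Matrix.vecMulVec (m r).ofLp (m r).ofLp‖ ≤
      2 * ∑ r, σ r * ‖(WithLp.toLp 2 (Z.mulVec (w r).ofLp) : EuclideanSpace ℝ α)‖ + ‖Z‖ ^ 2 := by
  set L := ∑ r, σ r • Matrix.vecMulVec (m r).ofLp (w r).ofLp with hL
  have hLt : L.transpose = ∑ r, σ r • Matrix.vecMulVec (w r).ofLp (m r).ofLp := by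
    rw [hL, Matrix.transpose_sum]
    refine Finset.sum_congr rfl fun r _ => ?_
    rw [Matrix.transpose_smul, Matrix.transpose_vecMulVec]
  have hZL : Z * L.transpose =
      ∑ r, σ r • Matrix.vecMulVec (Z.mulVec (w r).ofLp) (m r).ofLp := by
    rw [hLt, Matrix.mul_sum]
    refine Finset.sum_congr rfl fun r _ => ?_
    rw [Matrix.mul_smul, Matrix.mul_vecMulVec]
  have hLL : L * L.transpose = ∑ r, σ r ^ 2 • Matrix.vecMulVec (m r).ofLp (m r).ofLp := by
    rw [hLt, Matrix.mul_sum]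
    refine Finset.sum_congr rfl fun r _ => ?_
    have h1 : L.mulVec (w r).ofLp = σ r • (m r).ofLp := by
      rw [hL, Matrix.sum_mulVec, Finset.sum_eq_single r]
      · rw [Matrix.smul_mulVec, Matrix.vecMulVec_mulVec]
        have : (w r).ofLp ⬝ᵥ (w r).ofLp = 1 := by
          have h2 := EuclideanSpace.real_norm_sq_eq (w r)
          rw [hw.1 r, one_pow] at h2
          simpa [dotProduct, sq] using h2.symm
        simp [this]
      · intro r' _ hr
        rw [Matrix.smul_mulVec, Matrix.vecMulVec_mulVec]
        have : (w r').ofLp ⬝ᵥ (w r).ofLp = 0 := by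
          have := orthonormal_iff_ite.1 hw r r'
          rw [if_neg hr.symm] at this
          simpa [PiLp.inner_apply, dotProduct] using this
        simp [this]
      · simp
    rw [Matrix.mul_smul, Matrix.mul_vecMulVec, h1, Matrix.smul_vecMulVec, smul_smul, sq]
  have hexp : (L + Z) * (L + Z).transpose -
      ∑ r, σ r ^ 2 • Matrix.vecMulVec (m r).ofLp (m r).ofLp =
      Z * L.transpose + (Z * L.transpose).transpose + Z * Z.transpose := by
    rw [← hLL, Matrix.transpose_add, Matrix.transpose_mul, Matrix.transpose_transpose,
      Matrix.add_mul, Matrix.mul_add, Matrix.mul_add]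
    abel
  -- The cross term is estimated through each `Z w_r` rather than through `‖Z‖ * ‖L‖`: the noise on
  -- a fixed unit vector only sees the number of rows, which produces `√N_j` in the rate.
  have hZLn : ‖Z * L.transpose‖ ≤
      ∑ r, σ r * ‖(WithLp.toLp 2 (Z.mulVec (w r).ofLp) : EuclideanSpace ℝ α)‖ := by
    rw [hZL]
    refine (norm_sum_le _ _).trans (Finset.sum_le_sum fun r _ => ?_)
    rw [norm_smul, Real.norm_of_nonneg (hσ r)]
    refine mul_le_mul_of_nonneg_left ?_ (hσ r)
    refine (opNorm_vecMulVec_le (WithLp.toLp 2 (Z.mulVec (w r).ofLp)) (m r)).trans ?_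
    rw [hm.1 r, mul_one]
  rw [hexp]
  refine (norm_add_le _ _).trans ?_
  rw [opNorm_mul_transpose]
  refine add_le_add ((norm_add_le _ _).trans ?_) le_rfl
  rw [opNorm_transpose]
  linarith

/-- The deterministic error bound for the estimated loadings. -/
lemma norm_sub_normalized_mul_gap_le (hv : IsOrthogonal v) (hd : 2 ≤ d)
    (hσ : Antitone (scale v)) {U : Tensor N} {j : Fin d} {r : Fin R}
    {x : EuclideanSpace ℝ (Fin (N j))} (hx : IsPCAEstimate v (observed v U) j r x) :
    ‖x - normalized v j r‖ * gap v r ≤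
      3 * (2 * ∑ r, scale v r * ‖(WithLp.toLp 2 ((unfold U j).mulVec (coNormalized v j r).ofLp) :
        EuclideanSpace ℝ (Fin (N j)))‖ + ‖unfold U j‖ ^ 2) := by
  have hm := hv.orthonormal_normalized j
  have hpert := opNorm_gram_sub_le hm (hv.orthonormal_coNormalized hd j) (scale_nonneg v)
    (unfold U j)
  rw [← unfold_observed hv U j] at hpert
  refine norm_sub_mul_gap_le_of_isUnitEigenvector hm (τ := fun r => scale v r ^ 2)
    (fun a b hab => pow_le_pow_left₀ (scale_nonneg v b) (hσ hab) 2) (fun r => sq_nonneg _)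
    (fun y => ?_) hpert (gap_nonneg v r) (fun k hk => gap_le_of_ne v hk) (gap_le_sq v r)
    hx.eigenvector hx.sign
  ext a
  simp only [Matrix.sum_mulVec, Matrix.smul_mulVec, Matrix.vecMulVec_mulVec, WithLp.ofLp_sum,
    Finset.sum_apply, Pi.smul_apply, WithLp.ofLp_smul]
  refine Finset.sum_congr rfl fun k _ => ?_
  simp [PiLp.inner_apply, dotProduct, mul_comm, mul_left_comm]

end ModelStructure

/-! ### Second moments of the noise applied to a fixed vector. -/

section NoiseMoments

variable {ν : Measure ℝ} [IsProbabilityMeasure ν] {s ε : ℝ}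
  {Ω : Type*} [MeasurableSpace Ω] {P : Measure Ω} [IsProbabilityMeasure P]

omit [IsProbabilityMeasure P] in
lemma memLp_two_of_hasLaw (hε : 0 < ε)
    (hmoment : Integrable (fun x : ℝ => |x| ^ (4 + ε)) ν) {X : Ω → ℝ} (hX : HasLaw X ν P) :
    MemLp X 2 P := by
  have hL2 : MemLp (id : ℝ → ℝ) 2 ν :=
    (memLp_two_iff_integrable_sq measurable_id.aestronglyMeasurable).2
      (integrable_pow_of_moment hε hmoment (by norm_num))
  rw [← hX.map_eq] at hL2
  exact hL2.comp_of_map hX.aemeasurable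

lemma integral_sum_mul_sq (hε : 0 < ε)
    (hmoment : Integrable (fun x : ℝ => |x| ^ (4 + ε)) ν)
    (hmean : ∫ x, x ∂ν = 0) (hvar : variance id ν = s ^ 2)
    {β : Type*} [Fintype β] {X : β → Ω → ℝ} (hlaw : ∀ b, HasLaw (X b) ν P)
    (hind : iIndepFun X P) (w : β → ℝ) :
    Integrable (fun ω => (∑ b, X b ω * w b) ^ 2) P ∧
      ∫ ω, (∑ b, X b ω * w b) ^ 2 ∂P = s ^ 2 * ∑ b, w b ^ 2 := by
  have hL : ∀ b, MemLp (fun ω => X b ω * w b) 2 P := fun b =>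
    (memLp_two_of_hasLaw hε hmoment (hlaw b)).mul_const (w b)
  have hsum : MemLp (∑ b, fun ω => X b ω * w b) 2 P := memLp_finsetSum' _ fun b _ => hL b
  have hfun : (∑ b, fun ω => X b ω * w b) = fun ω => ∑ b, X b ω * w b := by
    ext ω; simp
  have hmeanX : ∀ b, ∫ ω, X b ω ∂P = 0 := fun b => (hlaw b).integral_eq.trans hmean
  have hmean0 : ∫ ω, (∑ b, fun ω => X b ω * w b) ω ∂P = 0 := by
    rw [hfun, integral_finsetSum _ fun b _ => (hL b).integrable (by norm_num)]
    refine Finset.sum_eq_zero fun b _ => ?_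
    rw [integral_mul_const, hmeanX, zero_mul]
  have hvar' : variance (∑ b, fun ω => X b ω * w b) P = s ^ 2 * ∑ b, w b ^ 2 := by
    rw [IndepFun.variance_sum (fun b _ => hL b), Finset.mul_sum]
    · refine Finset.sum_congr rfl fun b _ => ?_
      rw [variance_mul_const, (hlaw b).variance_eq, hvar]
    · intro b _ b' _ h
      exact (hind.indepFun h).comp (measurable_id.mul_const (w b)) (measurable_id.mul_const (w b'))
  rw [variance_eq_sub hsum, hmean0] at hvar'
  constructor
  · have := hsum.integrable_sq
    rwa [hfun] at this
  · rw [hfun] at hvar'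
    simpa using hvar'

/-- The noise applied to a unit vector is of the order of the square root of the number of rows. -/
lemma measure_norm_mulVec_sq_gt_le (hε : 0 < ε)
    (hmoment : Integrable (fun x : ℝ => |x| ^ (4 + ε)) ν)
    (hmean : ∫ x, x ∂ν = 0) (hvar : variance id ν = s ^ 2)
    {α β : Type*} [Fintype α] [Fintype β] {X : α × β → Ω → ℝ} (hlaw : ∀ e, HasLaw (X e) ν P)
    (hind : iIndepFun X P) {w : EuclideanSpace ℝ β} (hw : ‖w‖ = 1) {c : ℝ} (hc : 0 < c) :
    P {ω | c < ‖(WithLp.toLp 2 ((Matrix.of fun a b => X (a, b) ω : Matrix α β ℝ).mulVec w.ofLp) :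
        EuclideanSpace ℝ α)‖ ^ 2} ≤ ENNReal.ofReal (Fintype.card α * s ^ 2 / c) := by
  have hrow : ∀ a, Integrable (fun ω => (∑ b, X (a, b) ω * w b) ^ 2) P ∧
      ∫ ω, (∑ b, X (a, b) ω * w b) ^ 2 ∂P = s ^ 2 := fun a => by
    have h := integral_sum_mul_sq hε hmoment hmean hvar (X := fun b => X (a, b))
      (fun b => hlaw (a, b)) (hind.precomp (Prod.mk_right_injective a)) w.ofLp
    rwa [← EuclideanSpace.real_norm_sq_eq, hw, one_pow, mul_one] at h
  have hnorm : ∀ ω, ‖(WithLp.toLp 2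
      ((Matrix.of fun a b => X (a, b) ω : Matrix α β ℝ).mulVec w.ofLp) :
        EuclideanSpace ℝ α)‖ ^ 2 = ∑ a, (∑ b, X (a, b) ω * w b) ^ 2 := fun ω => by
    rw [EuclideanSpace.real_norm_sq_eq]
    rfl
  simp_rw [hnorm]
  have hmarkov := mul_meas_ge_le_integral_of_nonneg
    (Eventually.of_forall fun ω => (by positivity : 0 ≤ ∑ a, (∑ b, X (a, b) ω * w b) ^ 2))
    (integrable_finsetSum _ fun a _ => (hrow a).1) c
  rw [integral_finsetSum _ fun a _ => (hrow a).1] at hmarkov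
  simp_rw [(hrow _).2] at hmarkov
  have hsub : {ω | c < ∑ a, (∑ b, X (a, b) ω * w b) ^ 2} ⊆
      {ω | c ≤ ∑ a, (∑ b, X (a, b) ω * w b) ^ 2} := by
    intro ω hω
    simp only [Set.mem_ofPred_eq] at hω ⊢
    exact hω.le
  refine (measure_mono hsub).trans ?_
  rw [← ofReal_measureReal]
  refine ENNReal.ofReal_le_ofReal ?_
  rw [le_div_iff₀ hc, mul_comm]
  refine hmarkov.trans (le_of_eq ?_)
  simp

end NoiseMoments

/-! ### Rows and columns of the unfolding, and the error on the good event. -/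

section MainBound

open scoped Matrix.Norms.L2Operator

variable {d : ℕ} {N : Fin d → ℕ} {R : ℕ} {v : Loadings N R}

lemma card_columns (N : Fin d → ℕ) (j : Fin d) :
    Fintype.card (∀ k : {k // k ≠ j}, Fin (N k)) = ∏ k ∈ Finset.univ.erase j, N k := by
  rw [Fintype.card_pi]
  simp only [Fintype.card_fin]
  exact (Finset.prod_subtype (Finset.univ.erase j) (by simp) N).symm

/-- The noise terms are controlled on the complement of the exceptional events. -/
lemma norm_sub_normalized_mul_gap_le_rate (hv : IsOrthogonal v) (hd : 2 ≤ d)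
    (hσ : Antitone (scale v)) {U : Tensor N} {j : Fin d} {r : Fin R}
    {x : EuclideanSpace ℝ (Fin (N j))} (hx : IsPCAEstimate v (observed v U) j r x)
    {C c p : ℝ} (hC : 0 ≤ C) (hc : 0 ≤ c) (hp : 0 ≤ p) (hU : ‖unfold U j‖ ^ 2 ≤ C * p)
    (hw : ∀ r, ‖(WithLp.toLp 2 ((unfold U j).mulVec (coNormalized v j r).ofLp) :
        EuclideanSpace ℝ (Fin (N j)))‖ ^ 2 ≤ c ^ 2 * N j) :
    ‖x - normalized v j r‖ * gap v r ≤
      3 * (2 * c + C) * (√(N j : ℝ) * (scaleMatrix v).trace + p) := by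
  refine (norm_sub_normalized_mul_gap_le hv hd hσ hx).trans ?_
  have h1 : ∑ r, scale v r * ‖(WithLp.toLp 2 ((unfold U j).mulVec (coNormalized v j r).ofLp) :
        EuclideanSpace ℝ (Fin (N j)))‖ ≤ ∑ r, scale v r * (c * √(N j : ℝ)) := by
    refine Finset.sum_le_sum fun r _ => mul_le_mul_of_nonneg_left ?_ (scale_nonneg v r)
    have := Real.sqrt_le_sqrt (hw r)
    rwa [Real.sqrt_sq (norm_nonneg _), Real.sqrt_mul (sq_nonneg c), Real.sqrt_sq hc] at this
  rw [← Finset.sum_mul, ← trace_scaleMatrix] at h1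
  have ht : 0 ≤ (scaleMatrix v).trace := by
    rw [trace_scaleMatrix]; exact Finset.sum_nonneg fun r _ => scale_nonneg v r
  have h2 : 0 ≤ √(N j : ℝ) * (scaleMatrix v).trace := by positivity
  nlinarith [mul_nonneg hc hp, mul_nonneg hC h2]

lemma IsIIDNoise.unfold_law {Ω : Type*} [MeasurableSpace Ω] {U : Ω → Tensor N} {ν : Measure ℝ}
    {P : Measure Ω} (hU : IsIIDNoise U ν P) (j : Fin d)
    (e : Fin (N j) × ∀ k : {k // k ≠ j}, Fin (N k)) :
    HasLaw (fun ω => unfold (U ω) j e.1 e.2) ν P :=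
  hU.law _

lemma IsIIDNoise.unfold_indep {Ω : Type*} [MeasurableSpace Ω] {U : Ω → Tensor N} {ν : Measure ℝ}
    {P : Measure Ω} (hU : IsIIDNoise U ν P) (j : Fin d) :
    iIndepFun (fun (e : Fin (N j) × ∀ k : {k // k ≠ j}, Fin (N k)) ω =>
      unfold (U ω) j e.1 e.2) P :=
  hU.indep.precomp (Equiv.piSplitAt j fun k => Fin (N k)).symm.injective

end MainBound

end TensorPCA
-- The stochastic rate.
theorem theorem1 {ι : Type*} (l : Filter ι) {d : ℕ} (hd : 2 ≤ d) {R : ℕ}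
    (N : ι → Fin d → ℕ)
    (v : ∀ n, TensorPCA.Loadings (N n) R)
    (hv : ∀ n, TensorPCA.IsOrthogonal (v n))
    (hσ : ∀ n, Antitone (TensorPCA.scale (v n)))
    (ν : Measure ℝ) [IsProbabilityMeasure ν] (s ε : ℝ) (hε : 0 < ε)
    (hmean : ∫ x, x ∂ν = 0) (hvar : variance id ν = s ^ 2)
    (hmoment : Integrable (fun x : ℝ => |x| ^ (4 + ε)) ν)
    {Ω : ι → Type*} [∀ n, MeasurableSpace (Ω n)] (P : ∀ n, Measure (Ω n))
    [∀ n, IsProbabilityMeasure (P n)]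
    (U : ∀ n, Ω n → TensorPCA.Tensor (N n))
    (hU : ∀ n, TensorPCA.IsIIDNoise (U n) ν (P n))
    (mhat : ∀ n (j : Fin d), Fin R → Ω n → EuclideanSpace ℝ (Fin (N n j)))
    (hmhat : ∀ n j r ω, TensorPCA.IsPCAEstimate (v n)
      (TensorPCA.observed (v n) (U n ω)) j r (mhat n j r ω)) :
    ∀ (j : Fin d) (r : Fin R),
      TensorPCA.IsBigOP P l
        (fun n ω => mhat n j r ω - TensorPCA.normalized (v n) j r)
        (fun n => TensorPCA.rate (v n) j r) := by
  intro j r η hη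
  obtain ⟨η', hη'0, hη'⟩ : ∃ δ : ℝ, 0 < δ ∧ ENNReal.ofReal (δ + δ) ≤ η := by
    obtain ⟨q, hq0, hq⟩ := ENNReal.lt_iff_exists_nnreal_btwn.1 hη
    refine ⟨(q : ℝ) / 2, half_pos (by exact_mod_cast hq0), ?_⟩
    rw [add_halves, ENNReal.ofReal_coe_nnreal]
    exact hq.le
  obtain ⟨C, hC0, hC⟩ := TensorPCA.exists_opNorm_sq_bound hε hmoment hmean hvar hη'0
  -- Chosen so that the union bound `R * (s ^ 2 / c ^ 2)` over the factors is at most `η'`; the `+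
  -- 1` keeps `c` positive when `s = 0`.
  set c : ℝ := √((R * s ^ 2 + 1) / η') with hc
  have hc2 : c ^ 2 = (R * s ^ 2 + 1) / η' := Real.sq_sqrt (by positivity)
  have hc0 : 0 < c := Real.sqrt_pos.2 (by positivity)
  -- The bounds are uniform in the dimensions, so they hold for every `n` and no property of `l`
  -- enters.
  refine ⟨(3 * (2 * c + C)).toNNReal, Eventually.of_forall fun n => ?_⟩
  have hNj : ∀ k, 0 < N n k := (hv n).dim_pos r
  have hNjr : (0 : ℝ) < N n j := by exact_mod_cast hNj j
  set p : ℕ := max (N n j) (∏ k ∈ Finset.univ.erase j, N n k) with hp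
  have hp0 : 0 < p := lt_of_lt_of_le (hNj j) (le_max_left _ _)
  have hpr : max (N n j : ℝ) (∏ k ∈ Finset.univ.erase j, (N n k : ℝ)) = p := by
    rw [hp]; push_cast; rfl
  open scoped Matrix.Norms.L2Operator in
  set B₀ : Set (Ω n) := {ω | C * p < ‖TensorPCA.unfold (U n ω) j‖ ^ 2} with hB₀
  set B : Fin R → Set (Ω n) := fun k => {ω | c ^ 2 * N n j < ‖(WithLp.toLp 2
    ((TensorPCA.unfold (U n ω) j).mulVec (TensorPCA.coNormalized (v n) j k).ofLp) :
      EuclideanSpace ℝ (Fin (N n j)))‖ ^ 2} with hB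
  have hPB₀ : P n B₀ ≤ ENNReal.ofReal η' :=
    hC (P n) _ ((hU n).unfold_law j) ((hU n).unfold_indep j) p hp0
      (by rw [Fintype.card_fin]; exact le_max_left _ _)
      (by rw [TensorPCA.card_columns]; exact le_max_right _ _)
  have hPB : ∀ k, P n (B k) ≤ ENNReal.ofReal (s ^ 2 / c ^ 2) := fun k => by
    have h := TensorPCA.measure_norm_mulVec_sq_gt_le hε hmoment hmean hvar
      ((hU n).unfold_law j) ((hU n).unfold_indep j)
      (((hv n).orthonormal_coNormalized hd j).1 k) (by positivity : 0 < c ^ 2 * N n j)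
    rw [Fintype.card_fin, mul_comm (c ^ 2), mul_div_mul_left _ _ hNjr.ne'] at h
    rw [hB]
    simp only [mul_comm (c ^ 2)]
    exact h
  have hsub : {ω | ((3 * (2 * c + C)).toNNReal : ℝ≥0∞) * TensorPCA.rate (v n) j r <
      ‖mhat n j r ω - TensorPCA.normalized (v n) j r‖ₑ} ⊆ B₀ ∪ ⋃ k, B k := by
    intro ω hω
    by_contra hcon
    simp only [Set.mem_union, Set.mem_iUnion, not_or, not_exists] at hcon
    have hb := TensorPCA.norm_sub_normalized_mul_gap_le_rate (hv n) hd (hσ n) (hmhat n j r ω)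
      hC0.le hc0.le (Nat.cast_nonneg p) (not_lt.1 hcon.1) (fun k => not_lt.1 (hcon.2 k))
    rw [Set.mem_ofPred_eq] at hω
    refine absurd hω (not_lt.2 ?_)
    rw [TensorPCA.rate, hpr]
    have htr : 0 ≤ (TensorPCA.scaleMatrix (v n)).trace := by
      rw [TensorPCA.trace_scaleMatrix]
      exact Finset.sum_nonneg fun r _ => TensorPCA.scale_nonneg (v n) r
    have hpr0 : (0 : ℝ) < p := by exact_mod_cast hp0
    have hnum : 0 < √(N n j : ℝ) * (TensorPCA.scaleMatrix (v n)).trace + p := by positivity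
    have hcoe : ((3 * (2 * c + C)).toNNReal : ℝ≥0∞) = ENNReal.ofReal (3 * (2 * c + C)) := rfl
    rw [← mul_div_assoc, hcoe, ← ENNReal.ofReal_mul (by positivity)]
    -- In `ℝ≥0∞` a zero gap gives an infinite rate only because the numerator is positive; `0 / 0`
    -- would be `0`.
    rcases (TensorPCA.gap_nonneg (v n) r).eq_or_lt with hg | hg
    · rw [← hg, ENNReal.ofReal_zero, ENNReal.div_zero]
      · exact le_top
      · exact (ENNReal.ofReal_pos.2 (by positivity)).ne'
    · rw [← ENNReal.ofReal_div_of_pos hg, ← ofReal_norm]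
      exact ENNReal.ofReal_le_ofReal ((le_div_iff₀ hg).2 hb)
  calc P n _ ≤ P n (B₀ ∪ ⋃ k, B k) := measure_mono hsub
    _ ≤ P n B₀ + ∑ k, P n (B k) :=
        (measure_union_le _ _).trans (add_le_add_right (measure_iUnion_fintype_le _ _) _)
    _ ≤ ENNReal.ofReal η' + ∑ _k : Fin R, ENNReal.ofReal (s ^ 2 / c ^ 2) :=
        add_le_add hPB₀ (Finset.sum_le_sum fun k _ => hPB k)
    _ = ENNReal.ofReal (η' + R * (s ^ 2 / c ^ 2)) := by
        rw [ENNReal.ofReal_add hη'0.le (by positivity), ENNReal.ofReal_mul (by positivity)]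
        simp
    _ ≤ ENNReal.ofReal (η' + η') := by
        refine ENNReal.ofReal_le_ofReal (add_le_add le_rfl ?_)
        rw [hc2, div_div_eq_mul_div, ← mul_div_assoc, div_le_iff₀ (by positivity)]
        nlinarith
    _ ≤ η := hη'
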